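/- Let $\mathcal D\subseteq\mathbb R^n$ be open and connected, $t_0\in\mathbb R$, $\Omega:=\mathcal D\times[t_0,\infty)$, and let $F:\mathbb R^n\times[t_0,\infty)\rightrightarrows\mathbb R^n$ be a set-valued map such that: (i) (Filippov's existence hypotheses) for every $x_0\in\mathbb R^n$ and $s\ge t_0$ there are $a,b>0$ such that, on $\{\|x-x_0\|\le b,\ s\le t\le s+a\}$: for almost every $t$, and all $x$, the set $F(x,t)$ is nonempty, closed and convex and $F(\cdot,t)$ is upper semicontinuous at $x$; and there is an integrable $m:[s,s+a]\to\mathbb R$ such that for every $x$ there is a measurable $f_x:[s,s+a]\to\mathbb R^n$ with $f_x(t)\in F(x,t)$ and $\|f_x(t)\|\le m(t)$ for almost every $t$; (ii) (local boundedness uniformly in $t$) for every compact $K\subset\mathcal D$ there is $M>0$ with $\|y\|\le M$ for all $x\in K$, $t\ge t_0$, $y\in F(x,t)$. A solution of $\dot x\in F(x,t)$ over a nondegenerate interval $\mathcal I$ with $\min\mathcal I=t_0$ is a locally absolutely continuous $x:\mathcal I\to\mathbb R^n$ with $\dot x(t)\in F(x(t),t)$ for almost every $t\in\mathcal I$. It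 is maximal if it has no proper extension that is a solution, and complete if $\mathcal I=[t_0,\infty)$. Let $V:\Omega\to\mathbb R$ be a non-strict Lyapunov function for $F$ over $\Omega$ with the bounds $\underline W,\overline W,W:\mathcal D\to\mathbb R$, that is: $F(x,t)$ is nonempty and compact for all $(x,t)\in\Omega$; $V$ is locally Lipschitz and positive definite; $\underline W,\overline W$ are continuous and positive definite, and $W$ is continuous and nonnegative; $\underline W(x)\le V(x,t)\le\overline W(x)$ on $\Omega$; and, for almost every $t\ge t_0$ and all $x\in\mathcal D$, $$\max_{p\in\partial V(x,t)}\ \max_{q\in F(x,t)}p^T[q;1]\le -W(x),\qquad(\ast)$$ where $\partial V$ is the Clarke gradient of $V$ with respect to $(x,t)$. Then: 1. (Local result) Let $r>0$ with $\overline{\mathrm B}(0,r)\subset\mathcal D$ and let $0<c<\min_{\|x\|=r}\underline W(x)$. Every solution with $x(t_0)\in\{x\in\overline{\mathrm B}(0,r)\mid\overline W(x)\le c\}$ stays in $\mathcal D$, is bounded, and extends to a maximal solution; and every maximal solution with such an initial value is complete, bounded and satisfies $\lim_{t\to\infty}W(x(t))=0$. 2. (Global result) If $\mathcal D=\mathbb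 R^n$ and the sets $\{x\in\mathbb R^n\mid\underline W(x)\le c\}$ are compact for all $c>0$, then the same conclusions hold for all solutions, whatever $x(t_0)\in\mathbb R^n$. 3. (Regular case) If $V$ is moreover regular in the sense of Clarke (at every $(x,t)$ with $x\in\mathcal D$, $t>t_0$, all one-sided directional derivatives exist and equal Clarke's generalized directional derivatives), then 1 and 2 remain true when $(\ast)$ is relaxed to $$\min_{p\in\partial V(x,t)}\ \max_{q\in F(x,t)}p^T[q;1]\le -W(x)$$ for almost every $t\ge t_0$ and all $x\in\mathcal D$. -/

import Mathlib

open Set Filter Topology MeasureTheory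

noncomputable section

/-- Clarke's generalized directional derivative
`f°(x; v) = limsup_{y → x, s ↓ 0} (f (y + s v) - f y) / s`.
(It is only used at points near which `f` is Lipschitz, where the limsup is finite.) -/
def clarkeDeriv {X : Type*} [NormedAddCommGroup X] [NormedSpace ℝ X]
    (f : X → ℝ) (x v : X) : ℝ :=
  limsup (fun ys : X × ℝ => (f (ys.1 + ys.2 • v) - f ys.1) / ys.2) (𝓝 x ×ˢ 𝓝[>] (0 : ℝ))

/-- Clarke's generalized gradient: the linear functionals dominated by `f°(x; ·)`. -/
def clarkeGradient {X : Type*} [NormedAddCommGroup X] [NormedSpace ℝ X]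
    (f : X → ℝ) (x : X) : Set (X →L[ℝ] ℝ) :=
  {p | ∀ v, p v ≤ clarkeDeriv f x v}

/-- Clarke regularity at a point: every one-sided directional derivative exists and equals
the generalized directional derivative. -/
def IsClarkeRegularAt {X : Type*} [NormedAddCommGroup X] [NormedSpace ℝ X]
    (f : X → ℝ) (x : X) : Prop :=
  ∀ v, Tendsto (fun s : ℝ => (f (x + s • v) - f x) / s) (𝓝[>] 0) (𝓝 (clarkeDeriv f x v))

/-- `x` is a solution of `ẋ ∈ F (x, t)` over the interval `I` whose least element is `t₀`. -/
structure IsInclusionSolution {n : ℕ}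
    (F : EuclideanSpace ℝ (Fin n) → ℝ → Set (EuclideanSpace ℝ (Fin n)))
    (t₀ : ℝ) (I : Set ℝ) (x : ℝ → EuclideanSpace ℝ (Fin n)) : Prop where
  ordConnected : I.OrdConnected
  nontrivial : I.Nontrivial
  isLeast : IsLeast I t₀
  locallyAC : ∀ a ∈ I, ∀ b ∈ I, AbsolutelyContinuousOnInterval x a b
  inclusion : ∀ᵐ t ∂(volume.restrict I), DifferentiableAt ℝ x t ∧ deriv x t ∈ F (x t) t

/-- A solution is maximal if it has no proper extension that is also a solution. -/
def IsMaximalInclusionSolution {n : ℕ}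
    (F : EuclideanSpace ℝ (Fin n) → ℝ → Set (EuclideanSpace ℝ (Fin n)))
    (t₀ : ℝ) (I : Set ℝ) (x : ℝ → EuclideanSpace ℝ (Fin n)) : Prop :=
  IsInclusionSolution F t₀ I x ∧
    ∀ (J : Set ℝ) (y : ℝ → EuclideanSpace ℝ (Fin n)),
      IsInclusionSolution F t₀ J y → I ⊆ J → EqOn x y I → J = I

/-- Filippov's hypotheses on the cylinder `{‖x - x₀‖ ≤ b, s ≤ t ≤ s + a}`: for almost every `t`
the map `x ↦ F (x, t)` has nonempty closed convex values and is upper semicontinuous (the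
excess of `F (x', t)` over `F (x, t)` tends to `0` as `x' → x`), and for each `x` the map
`t ↦ F (x, t)` has a measurable selection, dominated by an integrable function of `t` that
does not depend on `x`. -/
def FilippovHypotheses {n : ℕ}
    (F : EuclideanSpace ℝ (Fin n) → ℝ → Set (EuclideanSpace ℝ (Fin n)))
    (x₀ : EuclideanSpace ℝ (Fin n)) (s a b : ℝ) : Prop :=
  (∀ᵐ t ∂(volume.restrict (Icc s (s + a))), ∀ x ∈ Metric.closedBall x₀ b,
    (F x t).Nonempty ∧ IsClosed (F x t) ∧ Convex ℝ (F x t) ∧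
    ∀ ε > 0, ∀ᶠ x' in 𝓝[Metric.closedBall x₀ b] x, F x' t ⊆ Metric.thickening ε (F x t)) ∧
  ∃ m : ℝ → ℝ, IntegrableOn m (Icc s (s + a)) ∧
    ∀ x ∈ Metric.closedBall x₀ b, ∃ f : ℝ → EuclideanSpace ℝ (Fin n),
      AEMeasurable f (volume.restrict (Icc s (s + a))) ∧
      ∀ᵐ t ∂(volume.restrict (Icc s (s + a))), f t ∈ F x t ∧ ‖f t‖ ≤ m t

/-- Filippov's hypotheses hold around every initial point `(x₀, s)` with `s ≥ t₀`. -/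
def SatisfiesFilippov {n : ℕ}
    (F : EuclideanSpace ℝ (Fin n) → ℝ → Set (EuclideanSpace ℝ (Fin n))) (t₀ : ℝ) : Prop :=
  ∀ (x₀ : EuclideanSpace ℝ (Fin n)) (s : ℝ), t₀ ≤ s →
    ∃ a > 0, ∃ b > 0, FilippovHypotheses F x₀ s a b

/-- `F` is locally bounded, uniformly in `t`, over `D × [t₀, ∞)`. -/
def LocallyBoundedUniformly {n : ℕ}
    (F : EuclideanSpace ℝ (Fin n) → ℝ → Set (EuclideanSpace ℝ (Fin n)))
    (D : Set (EuclideanSpace ℝ (Fin n))) (t₀ : ℝ) : Prop :=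
  ∀ K ⊆ D, IsCompact K → ∃ M > 0, ∀ x ∈ K, ∀ t, t₀ ≤ t → ∀ y ∈ F x t, ‖y‖ ≤ M

/-- Positive definite function on a set. -/
def IsPosDefOn {n : ℕ} (D : Set (EuclideanSpace ℝ (Fin n)))
    (f : EuclideanSpace ℝ (Fin n) → ℝ) : Prop :=
  f 0 = 0 ∧ ∀ x ∈ D, x ≠ 0 → 0 < f x

/-- The generalized time derivative `max_{p ∈ ∂V (x, t)} max_{q ∈ F (x, t)} pᵀ[q; 1]`. -/
def upperTimeDeriv {n : ℕ}
    (F : EuclideanSpace ℝ (Fin n) → ℝ → Set (EuclideanSpace ℝ (Fin n)))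
    (V : EuclideanSpace ℝ (Fin n) × ℝ → ℝ) (x : EuclideanSpace ℝ (Fin n)) (t : ℝ) : EReal :=
  ⨆ p ∈ clarkeGradient V (x, t), ⨆ q ∈ F x t, ((p (q, 1) : ℝ) : EReal)

/-- The relaxed generalized time derivative `min_{p ∈ ∂V (x, t)} max_{q ∈ F (x, t)} pᵀ[q; 1]`. -/
def lowerTimeDeriv {n : ℕ}
    (F : EuclideanSpace ℝ (Fin n) → ℝ → Set (EuclideanSpace ℝ (Fin n)))
    (V : EuclideanSpace ℝ (Fin n) × ℝ → ℝ) (x : EuclideanSpace ℝ (Fin n)) (t : ℝ) : EReal :=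
  ⨅ p ∈ clarkeGradient V (x, t), ⨆ q ∈ F x t, ((p (q, 1) : ℝ) : EReal)

/-- All requirements on a non-strict Lyapunov function over `D × [t₀, ∞)` with bounds
`Wlo`, `Whi`, `W`, except for the bound on its generalized time derivative. -/
structure IsLyapunovCandidate {n : ℕ}
    (F : EuclideanSpace ℝ (Fin n) → ℝ → Set (EuclideanSpace ℝ (Fin n)))
    (D : Set (EuclideanSpace ℝ (Fin n))) (t₀ : ℝ) (V : EuclideanSpace ℝ (Fin n) × ℝ → ℝ)
    (Wlo Whi W : EuclideanSpace ℝ (Fin n) → ℝ) : Prop where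
  nonempty_compact : ∀ x ∈ D, ∀ t, t₀ ≤ t → (F x t).Nonempty ∧ IsCompact (F x t)
  locallyLipschitz : LocallyLipschitzOn (D ×ˢ Ici t₀) V
  posDef : ∀ t, t₀ ≤ t → IsPosDefOn D (fun x => V (x, t))
  continuousOn_lo : ContinuousOn Wlo D
  posDef_lo : IsPosDefOn D Wlo
  continuousOn_hi : ContinuousOn Whi D
  posDef_hi : IsPosDefOn D Whi
  continuousOn_W : ContinuousOn W D
  nonneg_W : ∀ x ∈ D, 0 ≤ W x
  lo_le : ∀ x ∈ D, ∀ t, t₀ ≤ t → Wlo x ≤ V (x, t)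
  le_hi : ∀ x ∈ D, ∀ t, t₀ ≤ t → V (x, t) ≤ Whi x

/-- `V` is a non-strict Lyapunov function for `F` over `D × [t₀, ∞)` with bounds
`Wlo`, `Whi`, `W`. -/
def IsNonstrictLyapunov {n : ℕ}
    (F : EuclideanSpace ℝ (Fin n) → ℝ → Set (EuclideanSpace ℝ (Fin n)))
    (D : Set (EuclideanSpace ℝ (Fin n))) (t₀ : ℝ) (V : EuclideanSpace ℝ (Fin n) × ℝ → ℝ)
    (Wlo Whi W : EuclideanSpace ℝ (Fin n) → ℝ) : Prop :=
  IsLyapunovCandidate F D t₀ V Wlo Whi W ∧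
    ∀ᵐ t ∂(volume.restrict (Ici t₀)), ∀ x ∈ D, upperTimeDeriv F V x t ≤ ((-W x : ℝ) : EReal)

/-- `V` is a regular non-strict Lyapunov function in the relaxed sense: the maximum over the
Clarke gradient is replaced by the minimum. Regularity is required at the interior points of
`D × [t₀, ∞)`, where the Clarke gradient is determined by the values of `V` on that set. -/
def IsRegularRelaxedLyapunov {n : ℕ}
    (F : EuclideanSpace ℝ (Fin n) → ℝ → Set (EuclideanSpace ℝ (Fin n)))
    (D : Set (EuclideanSpace ℝ (Fin n))) (t₀ : ℝ) (V : EuclideanSpace ℝ (Fin n) × ℝ → ℝ)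
    (Wlo Whi W : EuclideanSpace ℝ (Fin n) → ℝ) : Prop :=
  IsLyapunovCandidate F D t₀ V Wlo Whi W ∧
    (∀ x ∈ D, ∀ t, t₀ < t → IsClarkeRegularAt V (x, t)) ∧
    ∀ᵐ t ∂(volume.restrict (Ici t₀)), ∀ x ∈ D, lowerTimeDeriv F V x t ≤ ((-W x : ℝ) : EReal)

/-- What is claimed of a solution `x : I → ℝⁿ`: it stays in `D` and is bounded, it extends to
a maximal solution, and if it is itself maximal, then it is complete and `W (x t) → 0`. -/
def CompleteBoundedConvergent {n : ℕ}
    (F : EuclideanSpace ℝ (Fin n) → ℝ → Set (EuclideanSpace ℝ (Fin n)))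
    (D : Set (EuclideanSpace ℝ (Fin n))) (t₀ : ℝ) (W : EuclideanSpace ℝ (Fin n) → ℝ)
    (I : Set ℝ) (x : ℝ → EuclideanSpace ℝ (Fin n)) : Prop :=
  MapsTo x I D ∧ Bornology.IsBounded (x '' I) ∧
  (∃ (J : Set ℝ) (y : ℝ → EuclideanSpace ℝ (Fin n)),
    I ⊆ J ∧ EqOn x y I ∧ IsMaximalInclusionSolution F t₀ J y) ∧
  (IsMaximalInclusionSolution F t₀ I x →
    I = Ici t₀ ∧ Tendsto (fun t => W (x t)) atTop (𝓝 0))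

end

/-!
Along a solution `x`, the function `t ↦ V (x t, t)` is Lipschitz on compact intervals on which `x`
stays in `D`, and almost everywhere its derivative is at most `-W (x t)`. Integration gives
`V (x t, t) + ∫ W (x τ) dτ ≤ V (x t₀, t₀)` (`IsInclusionSolution.lyapunov_add_integral_le`), hence
`Wlo (x t) ≤ Whi (x t₀)`, which confines `x` to a compact set `K ⊆ D`. There `F` is bounded, so
`x` is Lipschitz and `W ∘ x` is uniformly continuous with a bounded primitive, and Barbălat's lemma
gives `W (x t) → 0`.

The derivative of `V` along `x` is its derivative along the line in the direction
`(deriv x t, 1)`, because `V` is locally Lipschitz. It is at most Clarke's generalized directional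
derivative, which by the Hahn–Banach theorem is a value `p (deriv x t, 1)` with `p` in the Clarke
gradient. If `V` is regular, the two one-sided derivatives along the line show that every `p` in
the Clarke gradient takes the value of the derivative there, so that the minimum over `p` serves as
well as the maximum.

Maximal extensions come from Zorn's lemma. A maximal solution is complete: over a bounded interval
it would be Lipschitz, so it would have a limit in `K` at the right end, from which
Filippov's existence theorem (`exists_local_solution_of_bounded`) continues it. That theorem is
proved here for bounded right-hand sides. Euler polygons built from the measurable selections
converge uniformly along a subsequence, and for each direction `p` the limit `x` satisfies
`⟪p, x' t⟫ ≤ sup_{j ≥ k} ⟪p, g_j t⟫` for almost every `t`, where `g_j` are the velocities of the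
polygons (`ae_inner_deriv_le_iSup`). By upper semicontinuity the right-hand side is asymptotically
at most the support function of `F (x t, t)`, and a closed convex set is determined by its support
function on a dense set of directions.
-/

/-! ### Absolutely continuous curves -/

section AbsolutelyContinuous

theorem LipschitzWith.comp_absolutelyContinuousOnInterval {X Y : Type*} [PseudoMetricSpace X]
    [PseudoMetricSpace Y] {g : X → Y} {K : NNReal} (hg : LipschitzWith K g) {f : ℝ → X} {a b : ℝ}
    (hf : AbsolutelyContinuousOnInterval f a b) :
    AbsolutelyContinuousOnInterval (fun t => g (f t)) a b := by
  have h0 := (Tendsto.const_mul (K : ℝ) hf)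
  rw [mul_zero] at h0
  refine squeeze_zero (fun t => Finset.sum_nonneg fun i _ => dist_nonneg) (fun t => ?_) h0
  rw [Finset.mul_sum]
  exact Finset.sum_le_sum fun i _ => hg.dist_le_mul _ _

/-- Mean value inequality for absolutely continuous curves, obtained by testing the curve against
its own increment. -/
theorem AbsolutelyContinuousOnInterval.norm_sub_le {E : Type*} [NormedAddCommGroup E]
    [InnerProductSpace ℝ E] {x : ℝ → E} {a b M : ℝ}
    (hx : AbsolutelyContinuousOnInterval x a b) (hab : a ≤ b)
    (hd : ∀ᵐ t ∂(volume.restrict (Icc a b)), DifferentiableAt ℝ x t ∧ ‖deriv x t‖ ≤ M) :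
    ‖x b - x a‖ ≤ M * (b - a) := by
  set u := x b - x a with hu
  have hac : AbsolutelyContinuousOnInterval (fun t => innerSL ℝ u (x t)) a b :=
    (innerSL ℝ u).lipschitz.comp_absolutelyContinuousOnInterval hx
  have h1 := hac.integral_deriv_eq_sub
  have h2 : ∫ t in a..b, deriv (fun t => innerSL ℝ u (x t)) t ≤ ∫ t in a..b, ‖u‖ * M := by
    refine intervalIntegral.integral_mono_ae_restrict hab hac.intervalIntegrable_deriv
      (by simp) ?_
    filter_upwards [hd] with t ht
    have h3 : HasDerivAt (fun t => innerSL ℝ u (x t)) (innerSL ℝ u (deriv x t)) t :=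
      (innerSL ℝ u).hasFDerivAt.comp_hasDerivAt t ht.1.hasDerivAt
    rw [h3.deriv]
    exact (real_inner_le_norm _ _).trans (mul_le_mul_of_nonneg_left ht.2 (norm_nonneg _))
  rw [h1, intervalIntegral.integral_const, ← map_sub, ← hu, innerSL_apply_apply,
    real_inner_self_eq_norm_sq, smul_eq_mul] at h2
  rcases (norm_nonneg u).eq_or_lt with h | h
  · rw [← h]
    rcases hab.eq_or_lt with rfl | hlt
    · simp
    · have : (ae (volume.restrict (Icc a b))).NeBot := by
        rw [ae_neBot]
        intro h0
        have := congrArg (fun μ => μ univ) h0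
        simp [hlt.not_ge] at this
      obtain ⟨t, ht⟩ := hd.exists
      have : 0 ≤ M := (norm_nonneg _).trans ht.2
      exact mul_nonneg this (by linarith)
  · nlinarith

end AbsolutelyContinuous

/-! ### Local existence for differential inclusions -/

section Inclusion

variable {E : Type*} [NormedAddCommGroup E] [InnerProductSpace ℝ E] [FiniteDimensional ℝ E]

/-- A bounded closed convex set is an intersection of half-spaces whose normals run through a given
dense sequence. -/
theorem mem_of_forall_dense_inner_le {C : Set E} (hne : C.Nonempty) (hcl : IsClosed C)
    (hconv : Convex ℝ C) {M : ℝ} (hM : ∀ y ∈ C, ‖y‖ ≤ M) {d : ℕ → E} (hd : DenseRange d) {v : E}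
    (h : ∀ n u, (∀ y ∈ C, inner ℝ (d n) y ≤ u) → inner ℝ (d n) v ≤ u) : v ∈ C := by
  by_contra hv
  obtain ⟨w, hwC, hw⟩ := exists_norm_eq_iInf_of_complete_convex hne hcl.isComplete hconv v
  rw [norm_eq_iInf_iff_real_inner_le_zero hconv hwC] at hw
  have hp : 0 < ‖v - w‖ := by
    rw [norm_pos_iff, sub_ne_zero]
    rintro rfl
    exact hv hwC
  have hM0 : 0 ≤ M := (norm_nonneg _).trans (hM w hwC)
  have hδ : 0 < ‖v - w‖ ^ 2 / (M + ‖v‖ + 1) := by positivity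
  obtain ⟨n, hn⟩ := hd.exists_dist_lt (v - w) hδ
  rw [dist_comm, dist_eq_norm] at hn
  set δ := ‖d n - (v - w)‖
  have hδ1 : δ * (M + ‖v‖ + 1) < ‖v - w‖ ^ 2 := (lt_div_iff₀ (by positivity)).1 hn
  have hδ0 : 0 ≤ δ := norm_nonneg _
  have h1 := h n (inner ℝ (v - w) w + δ * M) (fun y hy => by
    have e1 : inner ℝ (d n) y = inner ℝ (v - w) (y - w) + inner ℝ (v - w) w
        + inner ℝ (d n - (v - w)) y := by
      simp only [inner_sub_left, inner_sub_right]; ring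
    have e2 : inner ℝ (d n - (v - w)) y ≤ δ * M :=
      (real_inner_le_norm _ _).trans (mul_le_mul_of_nonneg_left (hM y hy) hδ0)
    linarith [hw y hy])
  have e3 : inner ℝ (d n) v = inner ℝ (v - w) (v - w) + inner ℝ (v - w) w
        + inner ℝ (d n - (v - w)) v := by
      simp only [inner_sub_left, inner_sub_right]; ring
  have e4 : -(δ * ‖v‖) ≤ inner ℝ (d n - (v - w)) v :=
    neg_le_of_abs_le (abs_real_inner_le_norm _ _)
  rw [real_inner_self_eq_norm_sq] at e3
  linarith

/-- Arzelà–Ascoli for equi-Lipschitz curves with a common initial value, in the form of pointwise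
convergence on an interval to a curve which is Lipschitz on the whole line. -/
theorem exists_subseq_tendsto_of_lipschitz {M : NNReal} {X : ℕ → ℝ → E}
    (hX : ∀ j, LipschitzWith M (X j)) {x₀ : E} {s a : ℝ} (ha : 0 < a) (h0 : ∀ j, X j s = x₀) :
    ∃ (φ : ℕ → ℕ) (x : ℝ → E), StrictMono φ ∧ LipschitzWith M x ∧
      ∀ t ∈ Icc s (s + a), Tendsto (fun j => X (φ j) t) atTop (𝓝 (x t)) := by
  have hsa : s ≤ s + a := by linarith
  let Y : ℕ → BoundedContinuousFunction (Icc s (s + a)) E := fun j =>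
    BoundedContinuousFunction.mkOfCompact
      ⟨fun t => X j t, (hX j).continuous.comp continuous_subtype_val⟩
  have hYl : ∀ f ∈ range Y, LipschitzWith M f := by
    rintro _ ⟨j, rfl⟩
    exact (hX j).comp (LipschitzWith.subtype_val _) |>.weaken (by simp)
  have hcomp : IsCompact (closure (range Y)) := by
    refine BoundedContinuousFunction.arzela_ascoli (Metric.closedBall x₀ (M * a))
      (isCompact_closedBall _ _) _ ?_ ?_
    · rintro f t ⟨j, rfl⟩
      have := (hX j).dist_le_mul t s
      rw [h0] at this
      refine this.trans (mul_le_mul_of_nonneg_left ?_ M.2)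
      rw [Real.dist_eq, abs_of_nonneg (by linarith [t.2.1])]
      linarith [t.2.2]
    · exact (LipschitzWith.uniformEquicontinuous _ M fun f : range Y => hYl f f.2).equicontinuous
  obtain ⟨y, -, φ, hφ, hlim⟩ := hcomp.tendsto_subseq fun j => subset_closure (mem_range_self j)
  have hpt : ∀ t, Tendsto (fun j => Y (φ j) t) atTop (𝓝 (y t)) := fun t =>
    ((BoundedContinuousFunction.lipschitz_eval_const t).continuous.tendsto y).comp hlim
  have hyl : LipschitzWith M y := by
    refine LipschitzWith.of_dist_le_mul fun t t' => ?_
    exact le_of_tendsto ((hpt t).dist (hpt t'))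
      (Eventually.of_forall fun j => (hYl _ (mem_range_self _)).dist_le_mul t t')
  refine ⟨φ, IccExtend hsa y, hφ, ?_, fun t ht => ?_⟩
  · exact (hyl.comp (LipschitzWith.projIcc hsa)).weaken (by simp)
  · rw [IccExtend_of_mem hsa _ ht]
    exact hpt ⟨t, ht⟩

variable [MeasurableSpace E] [BorelSpace E]

theorem intervalIntegrable_of_norm_le {G : Type*} [NormedAddCommGroup G] {g : ℝ → G} {M : ℝ}
    (hg : AEStronglyMeasurable g volume) (hM : ∀ t, ‖g t‖ ≤ M) (a b : ℝ) :
    IntervalIntegrable g volume a b :=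
  (intervalIntegrable_const (c := M)).mono_fun' hg.restrict (ae_of_all _ hM)

theorem lipschitzWith_integral_of_norm_le {g : ℝ → E} {M : NNReal} (hg : Measurable g)
    (hM : ∀ t, ‖g t‖ ≤ M) (x₀ : E) (s : ℝ) :
    LipschitzWith M (fun t => x₀ + ∫ u in s..t, g u) := by
  refine LipschitzWith.of_dist_le_mul fun t t' => ?_
  have hi := intervalIntegrable_of_norm_le hg.aestronglyMeasurable hM
  rw [dist_add_left, dist_eq_norm, intervalIntegral.integral_interval_sub_left (hi _ _) (hi _ _),
    Real.dist_eq]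
  exact intervalIntegral.norm_integral_le_of_norm_le_const fun u _ => hM u

/-- Euler polygons: given a bounded field `f` measurable in time, a curve with velocity `g` such
that `g t` is the value of `f` at a node which the curve passed at most time `h` before `t`. -/
theorem exists_euler_velocity (f : E → ℝ → E) (hf : ∀ x, Measurable (f x)) {M : NNReal}
    (hM : ∀ x t, ‖f x t‖ ≤ M) (x₀ : E) {s a b h : ℝ} (hab : M * a ≤ b) (hh : 0 < h) :
    ∃ (g : ℝ → E) (y : ℕ → E), Measurable g ∧ (∀ t, ‖g t‖ ≤ M) ∧
      ∀ t ∈ Icc s (s + a), ∃ i, y i ∈ Metric.closedBall x₀ b ∧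
        dist (y i) (x₀ + ∫ u in s..t, g u) ≤ M * h ∧ g t = f (y i) t := by
  let y : ℕ → E := fun i => Nat.rec x₀
    (fun i z => z + ∫ t in (s + i * h)..(s + (i + 1 : ℕ) * h), f z t) i
  have hy : ∀ i, y (i + 1) = y i + ∫ t in (s + i * h)..(s + (i + 1 : ℕ) * h), f (y i) t :=
    fun i => rfl
  -- The node in force at time `t`, for steps `(s + i h, s + (i + 1) h]`; the truncated subtraction
  -- assigns `t = s` to the first step.
  let idx : ℝ → ℕ := fun t => ⌈(t - s) / h⌉₊ - 1
  let g : ℝ → E := fun t => f (y (idx t)) t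
  have hidx : Measurable idx :=
    (measurable_from_top (f := fun k : ℕ => k - 1)).comp
      (Nat.measurable_ceil.comp (by fun_prop))
  have hg : Measurable g := by
    have h1 : Measurable (fun q : ℕ × ℝ => f (y q.1) q.2) :=
      measurable_from_prod_countable_right fun i => hf (y i)
    exact h1.comp (hidx.prodMk measurable_id)
  have hgM : ∀ t, ‖g t‖ ≤ M := fun t => hM _ _
  have hgi := intervalIntegrable_of_norm_le hg.aestronglyMeasurable hgM
  have hX : ∀ i : ℕ, x₀ + ∫ u in s..(s + i * h), g u = y i := by
    intro i
    induction i with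
    | zero => simp [y]
    | succ i ih =>
      rw [hy, ← ih, add_assoc, ← intervalIntegral.integral_add_adjacent_intervals
        (hgi s (s + i * h)) (hgi _ _), ih]
      congr 2
      refine intervalIntegral.integral_congr_ae (ae_of_all _ fun t ht => ?_)
      have hle : s + i * h ≤ s + (i + 1 : ℕ) * h := by push_cast; nlinarith
      rw [uIoc_of_le hle] at ht
      have : ⌈(t - s) / h⌉₊ = i + 1 := by
        rw [Nat.ceil_eq_iff (by simp)]
        constructor
        · rw [lt_div_iff₀ hh]; push_cast [Nat.add_sub_cancel]; linarith [ht.1]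
        · rw [div_le_iff₀ hh]; linarith [ht.2]
      simp only [g, idx, this, Nat.add_sub_cancel]
  have hL := lipschitzWith_integral_of_norm_le hg hgM x₀ s
  refine ⟨g, y, hg, hgM, fun t ht => ⟨idx t, ?_, ?_, rfl⟩⟩
  all_goals
    have hts : 0 ≤ (t - s) / h := div_nonneg (by linarith [ht.1]) hh.le
    have h1 : (idx t : ℝ) * h ≤ t - s := by
      rw [← le_div_iff₀ hh]
      rcases Nat.eq_zero_or_pos ⌈(t - s) / h⌉₊ with h0 | h0
      · simp [idx, h0, hts]
      · have := Nat.ceil_lt_add_one hts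
        simp only [idx]
        rw [Nat.cast_sub h0]; push_cast; linarith
    have h2 : t - s ≤ (idx t : ℝ) * h + h := by
      have h3 : (t - s) / h ≤ (idx t : ℝ) + 1 := by
        refine (Nat.le_ceil _).trans ?_
        simp only [idx]
        exact_mod_cast (by omega)
      rw [div_le_iff₀ hh] at h3
      linarith
  · have := hL.dist_le_mul (s + idx t * h) s
    simp only [hX, intervalIntegral.integral_same, add_zero] at this
    refine this.trans (le_trans ?_ hab)
    refine mul_le_mul_of_nonneg_left ?_ M.2
    rw [Real.dist_eq, add_sub_cancel_left, abs_of_nonneg (by positivity)]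
    linarith [ht.2]
  · have := hL.dist_le_mul (s + idx t * h) t
    simp only [hX] at this
    refine this.trans (mul_le_mul_of_nonneg_left ?_ M.2)
    rw [Real.dist_eq, abs_le]
    constructor <;> linarith

/-- If curves with velocities `g j` converge pointwise to `x`, then, in each direction `p`, the
velocity of `x` is almost everywhere at most the supremum of the tail of the velocities: the
primitive of that supremum grows at least as fast as `⟪p, x⟫`. This replaces the extraction of a
weakly convergent subsequence of velocities. -/
theorem ae_inner_deriv_le_iSup {g : ℕ → ℝ → E} {M : ℝ} (hg : ∀ j, Measurable (g j))
    (hM : ∀ j t, ‖g j t‖ ≤ M) {x₀ : E} {s a : ℝ} {x : ℝ → E}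
    (hx : ∀ᵐ t ∂(volume.restrict (Icc s (s + a))), DifferentiableAt ℝ x t)
    (hlim : ∀ t ∈ Icc s (s + a), Tendsto (fun j => x₀ + ∫ u in s..t, g j u) atTop (𝓝 (x t)))
    (p : E) (k : ℕ) :
    ∀ᵐ t ∂(volume.restrict (Icc s (s + a))),
      inner ℝ p (deriv x t) ≤ ⨆ j, inner ℝ p (g (j + k) t) := by
  set S : ℝ → ℝ := fun t => ⨆ j, inner ℝ p (g (j + k) t)
  have hb : ∀ j t, |inner ℝ p (g j t)| ≤ ‖p‖ * M := fun j t =>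
    (abs_real_inner_le_norm _ _).trans (mul_le_mul_of_nonneg_left (hM j t) (norm_nonneg _))
  have hbdd : ∀ t, BddAbove (range fun j => inner ℝ p (g (j + k) t)) := fun t =>
    ⟨‖p‖ * M, by rintro _ ⟨j, rfl⟩; exact (abs_le.1 (hb _ _)).2⟩
  have hSm : Measurable S :=
    Measurable.iSup fun j => (measurable_const (a := p)).inner (hg _)
  have hSb : ∀ t, ‖S t‖ ≤ ‖p‖ * M := fun t => abs_le.2
    ⟨(abs_le.1 (hb _ _)).1.trans (le_ciSup (hbdd t) 0), ciSup_le fun j => (abs_le.1 (hb _ _)).2⟩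
  have hSi := intervalIntegrable_of_norm_le hSm.aestronglyMeasurable hSb
  have hSloc : LocallyIntegrable S volume := by
    have hc : LocallyIntegrable (fun _ : ℝ => ‖p‖ * M) volume := locallyIntegrable_const _
    exact hc.mono hSm.aestronglyMeasurable
      (ae_of_all _ fun t => (hSb t).trans (le_abs_self _))
  have hmono : MonotoneOn (fun t => (∫ u in s..t, S u) - inner ℝ p (x t)) (Icc s (s + a)) := by
    intro t ht t' ht' htt'
    have hl := Tendsto.inner (𝕜 := ℝ) (tendsto_const_nhds (x := p)) ((hlim t' ht').sub (hlim t ht))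
    have key : inner ℝ p (x t' - x t) ≤ ∫ u in t..t', S u := by
      refine le_of_tendsto hl ?_
      filter_upwards [eventually_ge_atTop k] with j hj
      have hgi := intervalIntegrable_of_norm_le (hg j).aestronglyMeasurable (hM j)
      rw [add_sub_add_left_eq_sub, intervalIntegral.integral_interval_sub_left (hgi _ _) (hgi _ _),
        ← innerSL_apply_apply ℝ p, ← ContinuousLinearMap.intervalIntegral_comp_comm _ (hgi _ _)]
      refine intervalIntegral.integral_mono_on htt' ?_ (hSi _ _) fun u _ => ?_
      · exact intervalIntegrable_of_norm_le
          (measurable_const.inner (hg j)).aestronglyMeasurable (M := ‖p‖ * M) (hb j) _ _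
      · obtain ⟨i, rfl⟩ := Nat.exists_eq_add_of_le' hj
        exact le_ciSup (hbdd u) i
    rw [inner_sub_right, ← intervalIntegral.integral_interval_sub_left (hSi s _) (hSi s _)] at key
    show _ - _ ≤ _ - _
    linarith
  have hend : ∀ᵐ t ∂(volume.restrict (Icc s (s + a))), t ∈ Ioo s (s + a) := by
    rw [← restrict_Ioo_eq_restrict_Icc]
    exact ae_restrict_mem measurableSet_Ioo
  filter_upwards [hx, ae_restrict_of_ae (LocallyIntegrable.ae_hasDerivAt_integral hSloc), hend] with t h1 h2 h3
  have h4 : HasDerivAt (fun t => (∫ u in s..t, S u) - inner ℝ p (x t))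
      (S t - inner ℝ p (deriv x t)) t := by
    refine (h2 s).sub ?_
    exact (innerSL ℝ p).hasFDerivAt.comp_hasDerivAt t h1.hasDerivAt
  have h5 := hmono.derivWithin_nonneg (x := t)
  rw [h4.hasDerivWithinAt.derivWithin
    (uniqueDiffOn_Icc (h3.1.trans h3.2) t (Ioo_subset_Icc_self h3))] at h5
  linarith

/-- Filippov's local existence theorem, for right-hand sides bounded by a constant. The condition
`M * a ≤ b` keeps all Euler polygons in the ball. -/
theorem exists_local_solution_of_bounded {F : E → ℝ → Set E} {x₀ : E} {s a b : ℝ} {M : NNReal}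
    (ha : 0 < a) (hab : M * a ≤ b)
    (hF : ∀ᵐ t ∂(volume.restrict (Icc s (s + a))), ∀ x ∈ Metric.closedBall x₀ b,
      (F x t).Nonempty ∧ IsClosed (F x t) ∧ Convex ℝ (F x t) ∧
      ∀ ε > 0, ∀ᶠ x' in 𝓝[Metric.closedBall x₀ b] x, F x' t ⊆ Metric.thickening ε (F x t))
    (hsel : ∀ x ∈ Metric.closedBall x₀ b, ∃ f : ℝ → E,
      AEMeasurable f (volume.restrict (Icc s (s + a))) ∧
      ∀ᵐ t ∂(volume.restrict (Icc s (s + a))), f t ∈ F x t)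
    (hM : ∀ x ∈ Metric.closedBall x₀ b, ∀ t ∈ Icc s (s + a), ∀ y ∈ F x t, ‖y‖ ≤ M) :
    ∃ x : ℝ → E, LipschitzWith M x ∧ x s = x₀ ∧
      ∀ᵐ t ∂(volume.restrict (Icc s (s + a))), DifferentiableAt ℝ x t ∧ deriv x t ∈ F (x t) t := by
  have hsa : s ≤ s + a := by linarith
  have hmem : ∀ᵐ t ∂(volume.restrict (Icc s (s + a))), t ∈ Icc s (s + a) :=
    ae_restrict_mem measurableSet_Icc
  -- Everywhere bounded, everywhere measurable selections.
  have hsel' : ∀ x, ∃ f : ℝ → E, Measurable f ∧ (∀ t, ‖f t‖ ≤ M) ∧ (x ∈ Metric.closedBall x₀ b →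
      ∀ᵐ t ∂(volume.restrict (Icc s (s + a))), f t ∈ F x t) := by
    intro x
    by_cases hx : x ∈ Metric.closedBall x₀ b
    · obtain ⟨f, hfm, hf⟩ := hsel x hx
      refine ⟨{t | ‖hfm.mk f t‖ ≤ M}.indicator (hfm.mk f),
        hfm.measurable_mk.indicator (measurableSet_le hfm.measurable_mk.norm measurable_const),
        fun t => ?_, fun _ => ?_⟩
      · by_cases h : ‖hfm.mk f t‖ ≤ M
        · simp [h]
        · simp [h]
      · filter_upwards [hf, hfm.ae_eq_mk, hmem] with t h1 h2 h3
        have h4 : t ∈ {t | ‖hfm.mk f t‖ ≤ M} := by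
          show ‖hfm.mk f t‖ ≤ M
          rw [← h2]
          exact hM x hx t h3 _ h1
        rw [indicator_of_mem h4, ← h2]
        exact h1
    · exact ⟨0, measurable_const, fun t => by simp, fun h => absurd h hx⟩
  choose f hfm hfM hfF using hsel'
  choose g y hgm hgM hgy using fun j : ℕ =>
    exists_euler_velocity f hfm hfM x₀ (s := s) hab (h := 1 / ((j : ℝ) + 1)) (by positivity)
  obtain ⟨φ, x, hφ, hxl, hlim⟩ := exists_subseq_tendsto_of_lipschitz
    (fun j => lipschitzWith_integral_of_norm_le (hgm j) (hgM j) x₀ s) ha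
    (x₀ := x₀) (s := s) (by simp)
  have hxd : ∀ᵐ t ∂(volume.restrict (Icc s (s + a))), DifferentiableAt ℝ x t :=
    ae_restrict_of_ae hxl.ae_differentiableAt_real
  have hxs : x s = x₀ := by
    refine tendsto_nhds_unique (hlim s ⟨le_rfl, hsa⟩) ?_
    simp
  refine ⟨x, hxl, hxs, ?_⟩
  have hsup := fun n k => ae_inner_deriv_le_iSup (fun j => hgm (φ j)) (fun j => hgM (φ j)) hxd hlim
    (TopologicalSpace.denseSeq E n) k
  simp only [← ae_all_iff] at hsup
  have hyF : ∀ᵐ t ∂(volume.restrict (Icc s (s + a))), ∀ j i, y j i ∈ Metric.closedBall x₀ b →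
      f (y j i) t ∈ F (y j i) t := by
    simp only [ae_all_iff]
    exact fun j i h => hfF _ h
  filter_upwards [hxd, hsup, hyF, hF, hmem] with t h1 h2 h3 h4 ht
  refine ⟨h1, ?_⟩
  have hxb : x t ∈ Metric.closedBall x₀ b := by
    have := hxl.dist_le_mul t s
    rw [hxs] at this
    refine this.trans (le_trans (mul_le_mul_of_nonneg_left ?_ M.2) hab)
    rw [Real.dist_eq, abs_of_nonneg (by linarith [ht.1])]
    linarith [ht.2]
  obtain ⟨hne, hcl, hconv, husc⟩ := h4 _ hxb
  refine mem_of_forall_dense_inner_le hne hcl hconv (hM _ hxb t ht)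
    (TopologicalSpace.denseRange_denseSeq E) fun n u hu => ?_
  choose i hib hid hig using fun j => hgy j t ht
  have hz : Tendsto (fun j => y (φ j) (i (φ j))) atTop (𝓝[Metric.closedBall x₀ b] (x t)) := by
    refine tendsto_nhdsWithin_iff.2 ⟨?_, Eventually.of_forall fun j => hib _⟩
    refine (tendsto_iff_of_dist ?_).2 (hlim t ht)
    have h0 : Tendsto (fun j : ℕ => (M : ℝ) * (1 / ((φ j : ℝ) + 1))) atTop (𝓝 0) := by
      have := (tendsto_one_div_add_atTop_nhds_zero_nat (𝕜 := ℝ)).comp hφ.tendsto_atTop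
      simpa using this.const_mul (M : ℝ)
    exact squeeze_zero (fun _ => dist_nonneg) (fun j => hid _) h0
  set p := TopologicalSpace.denseSeq E n
  refine le_of_forall_pos_le_add fun ε hε => ?_
  have hε' : 0 < ε / (‖p‖ + 1) := by positivity
  obtain ⟨k, hk⟩ := eventually_atTop.1 (hz.eventually (husc _ hε'))
  refine (h2 n k).trans (ciSup_le fun j => ?_)
  have h5 : g (φ (j + k)) t ∈ F (y (φ (j + k)) (i (φ (j + k)))) t := by
    rw [hig]
    exact h3 _ _ (hib _)
  obtain ⟨w, hw, hwd⟩ := Metric.mem_thickening_iff.1 (hk (j + k) (by omega) h5)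
  rw [dist_eq_norm] at hwd
  have h6 : inner ℝ p (g (φ (j + k)) t) = inner ℝ p w + inner ℝ p (g (φ (j + k)) t - w) := by
    rw [inner_sub_right]; ring
  have h7 : inner ℝ p (g (φ (j + k)) t - w) ≤ ‖p‖ * (ε / (‖p‖ + 1)) :=
    (real_inner_le_norm _ _).trans (mul_le_mul_of_nonneg_left hwd.le (norm_nonneg _))
  have h8 : ‖p‖ * (ε / (‖p‖ + 1)) ≤ ε := by
    rw [← mul_div_assoc, div_le_iff₀ (by positivity)]
    nlinarith [norm_nonneg p]
  linarith [hu w hw]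

end Inclusion

/-! ### The Clarke gradient -/

section Clarke

variable {X : Type*} [NormedAddCommGroup X] [NormedSpace ℝ X] {f : X → ℝ} {x : X} {K : NNReal}
  {s : Set X}

theorem tendsto_clarke_shift (x v : X) :
    Tendsto (fun ys : X × ℝ => ys.1 + ys.2 • v) (𝓝 x ×ˢ 𝓝[>] (0 : ℝ)) (𝓝 x) := by
  have h : Tendsto (fun ys : X × ℝ => ys.1 + ys.2 • v) (𝓝 (x, (0 : ℝ))) (𝓝 (x + (0 : ℝ) • v)) :=
    Continuous.tendsto (by fun_prop) (x, (0 : ℝ))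
  rw [zero_smul, add_zero, nhds_prod_eq] at h
  exact h.mono_left (prod_mono_right _ nhdsWithin_le_nhds)

theorem eventually_abs_clarke_quotient_le (hs : s ∈ 𝓝 x) (hf : LipschitzOnWith K f s) (v : X) :
    ∀ᶠ ys : X × ℝ in 𝓝 x ×ˢ 𝓝[>] (0 : ℝ),
      |(f (ys.1 + ys.2 • v) - f ys.1) / ys.2| ≤ K * ‖v‖ := by
  filter_upwards [tendsto_fst.eventually hs, (tendsto_clarke_shift x v).eventually hs,
    tendsto_snd.eventually self_mem_nhdsWithin] with ys h1 h2 (h3 : 0 < ys.2)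
  have h4 := hf.dist_le_mul _ h2 _ h1
  rw [Real.dist_eq, dist_eq_norm, add_sub_cancel_left, norm_smul, Real.norm_eq_abs,
    abs_of_pos h3] at h4
  rw [abs_div, abs_of_pos h3, div_le_iff₀ h3]
  linarith

theorem isBoundedUnder_clarke_quotient (hs : s ∈ 𝓝 x) (hf : LipschitzOnWith K f s) (v : X) :
    IsBoundedUnder (· ≤ ·) (𝓝 x ×ˢ 𝓝[>] (0 : ℝ))
      (fun ys : X × ℝ => (f (ys.1 + ys.2 • v) - f ys.1) / ys.2) :=
  isBoundedUnder_of_eventually_le (a := K * ‖v‖)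
    ((eventually_abs_clarke_quotient_le hs hf v).mono fun _ h => (abs_le.1 h).2)

theorem isCoboundedUnder_clarke_quotient (hs : s ∈ 𝓝 x) (hf : LipschitzOnWith K f s) (v : X) :
    IsCoboundedUnder (· ≤ ·) (𝓝 x ×ˢ 𝓝[>] (0 : ℝ))
      (fun ys : X × ℝ => (f (ys.1 + ys.2 • v) - f ys.1) / ys.2) :=
  IsBoundedUnder.isCoboundedUnder_le (isBoundedUnder_of_eventually_ge (a := -(K * ‖v‖))
    ((eventually_abs_clarke_quotient_le hs hf v).mono fun _ h => (abs_le.1 h).1))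

theorem clarkeDeriv_le_of_eventually_le (hs : s ∈ 𝓝 x) (hf : LipschitzOnWith K f s) {v : X}
    {c : ℝ} (h : ∀ᶠ ys : X × ℝ in 𝓝 x ×ˢ 𝓝[>] (0 : ℝ),
      (f (ys.1 + ys.2 • v) - f ys.1) / ys.2 ≤ c) : clarkeDeriv f x v ≤ c :=
  limsup_le_of_le (isCoboundedUnder_clarke_quotient hs hf v) h

theorem eventually_lt_of_clarkeDeriv_lt (hs : s ∈ 𝓝 x) (hf : LipschitzOnWith K f s) {v : X}
    {c : ℝ} (h : clarkeDeriv f x v < c) : ∀ᶠ ys : X × ℝ in 𝓝 x ×ˢ 𝓝[>] (0 : ℝ),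
      (f (ys.1 + ys.2 • v) - f ys.1) / ys.2 < c :=
  eventually_lt_of_limsup_lt h (isBoundedUnder_clarke_quotient hs hf v)

theorem clarkeDeriv_add_le (hs : s ∈ 𝓝 x) (hf : LipschitzOnWith K f s) (v w : X) :
    clarkeDeriv f x (v + w) ≤ clarkeDeriv f x v + clarkeDeriv f x w := by
  refine le_of_forall_pos_le_add fun ε hε => ?_
  have hshift : Tendsto (fun ys : X × ℝ => (ys.1 + ys.2 • w, ys.2))
      (𝓝 x ×ˢ 𝓝[>] (0 : ℝ)) (𝓝 x ×ˢ 𝓝[>] (0 : ℝ)) :=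
    (tendsto_clarke_shift x w).prodMk tendsto_snd
  refine clarkeDeriv_le_of_eventually_le hs hf ?_
  filter_upwards [hshift.eventually
    (eventually_lt_of_clarkeDeriv_lt hs hf (v := v) (lt_add_of_pos_right _ (half_pos hε))),
    eventually_lt_of_clarkeDeriv_lt hs hf (v := w) (lt_add_of_pos_right _ (half_pos hε))]
    with ys h1 h2
  have h3 : (f (ys.1 + ys.2 • (v + w)) - f ys.1) / ys.2
      = (f (ys.1 + ys.2 • w + ys.2 • v) - f (ys.1 + ys.2 • w)) / ys.2
        + (f (ys.1 + ys.2 • w) - f ys.1) / ys.2 := by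
    rw [← add_div, smul_add, add_comm (ys.2 • v), ← add_assoc]
    ring
  rw [h3]
  linarith

theorem clarkeDeriv_smul_le (hs : s ∈ 𝓝 x) (hf : LipschitzOnWith K f s) {c : ℝ} (hc : 0 < c)
    (v : X) : clarkeDeriv f x (c • v) ≤ c * clarkeDeriv f x v := by
  refine le_of_forall_pos_le_add fun ε hε => ?_
  have hscale : Tendsto (fun r : ℝ => c * r) (𝓝[>] (0 : ℝ)) (𝓝[>] (0 : ℝ)) := by
    refine tendsto_nhdsWithin_iff.2 ⟨?_, ?_⟩
    · have : Tendsto (fun r : ℝ => c * r) (𝓝 0) (𝓝 (c * 0)) := by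
        exact Continuous.tendsto (by fun_prop) 0
      rw [mul_zero] at this
      exact this.mono_left nhdsWithin_le_nhds
    · filter_upwards [self_mem_nhdsWithin] with r hr
      exact mul_pos hc hr
  have hshift : Tendsto (fun ys : X × ℝ => (ys.1, c * ys.2))
      (𝓝 x ×ˢ 𝓝[>] (0 : ℝ)) (𝓝 x ×ˢ 𝓝[>] (0 : ℝ)) :=
    tendsto_fst.prodMk (hscale.comp tendsto_snd)
  refine clarkeDeriv_le_of_eventually_le hs hf ?_
  filter_upwards [hshift.eventually
    (eventually_lt_of_clarkeDeriv_lt hs hf (v := v) (lt_add_of_pos_right _ (div_pos hε hc))),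
    tendsto_snd.eventually self_mem_nhdsWithin] with ys h1 (h2 : 0 < ys.2)
  have h3 : (f (ys.1 + ys.2 • c • v) - f ys.1) / ys.2
      = c * ((f (ys.1 + (c * ys.2) • v) - f ys.1) / (c * ys.2)) := by
    rw [smul_smul, mul_comm ys.2 c]
    field_simp
  rw [h3]
  calc _ ≤ c * (clarkeDeriv f x v + ε / c) := mul_le_mul_of_nonneg_left h1.le hc.le
    _ = _ := by field_simp

theorem clarkeDeriv_smul (hs : s ∈ 𝓝 x) (hf : LipschitzOnWith K f s) {c : ℝ} (hc : 0 < c)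
    (v : X) : clarkeDeriv f x (c • v) = c * clarkeDeriv f x v := by
  refine le_antisymm (clarkeDeriv_smul_le hs hf hc v) ?_
  have h := clarkeDeriv_smul_le hs hf (inv_pos.2 hc) (c • v)
  rw [inv_smul_smul₀ hc.ne'] at h
  calc c * clarkeDeriv f x v ≤ c * (c⁻¹ * clarkeDeriv f x (c • v)) :=
        mul_le_mul_of_nonneg_left h hc.le
    _ = _ := mul_inv_cancel_left₀ hc.ne' _

/-- The generalized directional derivative is the support function of the Clarke gradient, and the
maximum is attained. -/
theorem exists_mem_clarkeGradient_eq [FiniteDimensional ℝ X] (hs : s ∈ 𝓝 x)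
    (hf : LipschitzOnWith K f s) {v : X} (hv : v ≠ 0) :
    ∃ p ∈ clarkeGradient f x, p v = clarkeDeriv f x v := by
  have h0 : clarkeDeriv f x 0 = 0 := by
    have := clarkeDeriv_smul hs hf (two_pos) (0 : X)
    rw [smul_zero] at this
    linarith
  obtain ⟨p, hp1, hp2⟩ := exists_extension_of_le_sublinear
    (LinearPMap.mkSpanSingleton (K := ℝ) v (clarkeDeriv f x v) hv) (clarkeDeriv f x)
    (fun c hc w => clarkeDeriv_smul hs hf hc w) (clarkeDeriv_add_le hs hf) (by
      rintro ⟨w, hw⟩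
      obtain ⟨c, rfl⟩ := Submodule.mem_span_singleton.1 hw
      rw [show LinearPMap.mkSpanSingleton (K := ℝ) v (clarkeDeriv f x v) hv ⟨c • v, hw⟩
          = c * clarkeDeriv f x v from LinearPMap.mkSpanSingleton'_apply _ _ _ c hw]
      show _ ≤ clarkeDeriv f x (c • v)
      rcases lt_trichotomy c 0 with hc | rfl | hc
      · have h1 := clarkeDeriv_add_le hs hf (c • v) ((-c) • v)
        rw [← add_smul, add_neg_cancel, zero_smul, h0,
          clarkeDeriv_smul hs hf (neg_pos.2 hc)] at h1
        linarith
      · simp [h0]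
      · exact (clarkeDeriv_smul hs hf hc v).ge)
  refine ⟨LinearMap.toContinuousLinearMap p, fun w => hp2 w, ?_⟩
  have := hp1 ⟨v, Submodule.mem_span_singleton_self v⟩
  rw [LinearPMap.mkSpanSingleton_apply] at this
  exact this

theorem le_clarkeDeriv_of_hasDerivAt (hs : s ∈ 𝓝 x) (hf : LipschitzOnWith K f s) {v : X} {d : ℝ}
    (hd : HasDerivAt (fun r : ℝ => f (x + r • v)) d 0) : d ≤ clarkeDeriv f x v := by
  have h1 : Tendsto (fun r : ℝ => (f (x + r • v) - f x) / r) (𝓝[>] 0) (𝓝 d) := by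
    have := hd.tendsto_slope_zero_right
    simpa [div_eq_inv_mul] using this
  have h2 : Tendsto (fun r : ℝ => (x, r)) (𝓝[>] 0) (𝓝 x ×ˢ 𝓝[>] (0 : ℝ)) :=
    tendsto_const_nhds.prodMk tendsto_id
  refine le_of_forall_pos_le_add fun ε hε => le_of_tendsto h1 ?_
  exact (h2.eventually (eventually_lt_of_clarkeDeriv_lt hs hf
    (lt_add_of_pos_right _ hε))).mono fun _ h => h.le

/-- At a point of regularity where the derivative of `f` along the line in direction `v` exists,
all elements of the Clarke gradient take the value of that derivative at `v`. -/
theorem IsClarkeRegularAt.apply_eq_of_hasDerivAt (hr : IsClarkeRegularAt f x) {v : X} {d : ℝ}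
    (hd : HasDerivAt (fun r : ℝ => f (x + r • v)) d 0) {p : X →L[ℝ] ℝ}
    (hp : p ∈ clarkeGradient f x) : p v = d := by
  have h1 : clarkeDeriv f x v = d := by
    refine tendsto_nhds_unique (hr v) ?_
    have := hd.tendsto_slope_zero_right
    simpa [div_eq_inv_mul] using this
  have hd' : HasDerivAt (fun r : ℝ => f (x + r • -v)) (-d) 0 := by
    have hn : HasDerivAt (fun r : ℝ => -r) (-1) 0 := (hasDerivAt_id 0).neg
    have := HasDerivAt.comp (h₂ := fun r : ℝ => f (x + r • v)) (h := fun r : ℝ => -r) 0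
      (by simpa using hd) hn
    simpa [Function.comp_def] using this
  have h2 : clarkeDeriv f x (-v) = -d := by
    refine tendsto_nhds_unique (hr (-v)) ?_
    have := hd'.tendsto_slope_zero_right
    simpa [div_eq_inv_mul] using this
  have h3 := hp v
  have h4 := hp (-v)
  rw [map_neg, h2] at h4
  rw [h1] at h3
  linarith

/-- A locally Lipschitz function has the same derivative along a curve and along its tangent. -/
theorem LipschitzOnWith.hasDerivAt_tangent {γ : ℝ → X} {t d : ℝ} {v : X} (hs : s ∈ 𝓝 (γ t))
    (hf : LipschitzOnWith K f s) (hγ : HasDerivAt γ v t)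
    (hd : HasDerivAt (fun τ => f (γ τ)) d t) :
    HasDerivAt (fun r : ℝ => f (γ t + r • v)) d 0 := by
  have hc : ContinuousAt γ t := hγ.continuousAt
  rw [hasDerivAt_iff_isLittleO_nhds_zero] at hd hγ ⊢
  have h1 : Tendsto (fun r : ℝ => γ (t + r)) (𝓝 0) (𝓝 (γ t)) := by
    have : Tendsto (fun r : ℝ => t + r) (𝓝 0) (𝓝 t) := by
      have := Continuous.tendsto (f := fun r : ℝ => t + r) (by fun_prop) 0
      simpa using this
    exact hc.tendsto.comp this
  have h2 : Tendsto (fun r : ℝ => γ t + r • v) (𝓝 0) (𝓝 (γ t)) := by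
    have := Continuous.tendsto (f := fun r : ℝ => γ t + r • v) (by fun_prop) 0
    simpa using this
  have h3 : (fun r : ℝ => f (γ t + r • v) - f (γ (t + r))) =O[𝓝 0]
      fun r : ℝ => γ (t + r) - γ t - r • v := by
    refine Asymptotics.IsBigO.of_bound K ?_
    filter_upwards [h1.eventually hs, h2.eventually hs] with r hr1 hr2
    have := hf.dist_le_mul _ hr2 _ hr1
    rw [Real.dist_eq, dist_comm, dist_eq_norm] at this
    rwa [Real.norm_eq_abs, sub_sub]
  refine ((h3.trans_isLittleO hγ).add hd).congr_left fun r => ?_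
  simp only [zero_add, zero_smul, add_zero]
  ring

end Clarke

/-! ### Derivatives along trajectories -/

section TimeDerivative

variable {n : ℕ} {F : EuclideanSpace ℝ (Fin n) → ℝ → Set (EuclideanSpace ℝ (Fin n))}
  {V : EuclideanSpace ℝ (Fin n) × ℝ → ℝ} {x : ℝ → EuclideanSpace ℝ (Fin n)} {t d : ℝ}
  {K : NNReal} {s : Set (EuclideanSpace ℝ (Fin n) × ℝ)}

theorem hasDerivAt_line_of_trajectory (hs : s ∈ 𝓝 (x t, t)) (hV : LipschitzOnWith K V s)
    (hx : DifferentiableAt ℝ x t) (hd : HasDerivAt (fun τ => V (x τ, τ)) d t) :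
    HasDerivAt (fun r : ℝ => V ((x t, t) + r • (deriv x t, (1 : ℝ)))) d 0 :=
  LipschitzOnWith.hasDerivAt_tangent (γ := fun τ => (x τ, τ)) hs hV
    (hx.hasDerivAt.prodMk (hasDerivAt_id t)) hd

theorem le_upperTimeDeriv (hs : s ∈ 𝓝 (x t, t)) (hV : LipschitzOnWith K V s)
    (hx : DifferentiableAt ℝ x t) (hxF : deriv x t ∈ F (x t) t)
    (hd : HasDerivAt (fun τ => V (x τ, τ)) d t) : (d : EReal) ≤ upperTimeDeriv F V (x t) t := by
  have hl := hasDerivAt_line_of_trajectory hs hV hx hd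
  obtain ⟨p, hp, hpv⟩ := exists_mem_clarkeGradient_eq hs hV
    (v := (deriv x t, (1 : ℝ))) (fun h => one_ne_zero (congrArg Prod.snd h))
  refine le_trans ?_ (le_iSup₂_of_le p hp (le_iSup₂_of_le _ hxF le_rfl))
  rw [hpv]
  exact EReal.coe_le_coe (le_clarkeDeriv_of_hasDerivAt hs hV hl)

theorem le_lowerTimeDeriv (hs : s ∈ 𝓝 (x t, t)) (hV : LipschitzOnWith K V s)
    (hr : IsClarkeRegularAt V (x t, t))
    (hx : DifferentiableAt ℝ x t) (hxF : deriv x t ∈ F (x t) t)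
    (hd : HasDerivAt (fun τ => V (x τ, τ)) d t) : (d : EReal) ≤ lowerTimeDeriv F V (x t) t := by
  have hl := hasDerivAt_line_of_trajectory hs hV hx hd
  refine le_iInf₂ fun p hp => le_iSup₂_of_le _ hxF ?_
  rw [hr.apply_eq_of_hasDerivAt hl hp]

end TimeDerivative

/-! ### Barbălat's lemma -/

section Barbalat

/-- **Barbălat's lemma**: a nonnegative uniformly continuous function on `[t₀, ∞)` with bounded
primitive tends to zero. -/
theorem tendsto_zero_of_uniformContinuousOn_of_integral_le {w : ℝ → ℝ} {t₀ C : ℝ}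
    (hw : UniformContinuousOn w (Ici t₀)) (hnn : ∀ t, t₀ ≤ t → 0 ≤ w t)
    (hC : ∀ t, t₀ ≤ t → ∫ u in t₀..t, w u ≤ C) : Tendsto w atTop (𝓝 0) := by
  have hint : ∀ a b, t₀ ≤ a → t₀ ≤ b → IntervalIntegrable w volume a b := fun a b ha hb =>
    (hw.continuousOn.mono fun t ht => (le_min ha hb).trans ht.1).intervalIntegrable
  set G : ℝ → ℝ := fun t => ∫ u in t₀..max t₀ t, w u
  have hsub : ∀ a b, t₀ ≤ a → a ≤ b → G b - G a = ∫ u in a..b, w u := by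
    intro a b ha hab
    simp only [G]
    rw [max_eq_right ha, max_eq_right (ha.trans hab)]
    exact intervalIntegral.integral_interval_sub_left (hint _ _ le_rfl (ha.trans hab))
      (hint _ _ le_rfl ha)
  have hmono : Monotone G := by
    intro a b hab
    have h1 : max t₀ a ≤ max t₀ b := max_le_max_left _ hab
    have h2 := hsub (max t₀ a) (max t₀ b) (le_max_left _ _) h1
    have h3 : 0 ≤ ∫ u in (max t₀ a)..(max t₀ b), w u :=
      intervalIntegral.integral_nonneg h1 fun u hu => hnn u ((le_max_left _ _).trans hu.1)
    simp only [G, max_eq_right (le_max_left t₀ _)] at h2 ⊢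
    linarith
  have hlim := tendsto_atTop_ciSup hmono
    ⟨C, by rintro _ ⟨t, rfl⟩; exact hC _ (le_max_left _ _)⟩
  rw [Metric.tendsto_atTop]
  intro ε hε
  obtain ⟨δ, hδ, huc⟩ := Metric.uniformContinuousOn_iff.1 hw (ε / 2) (half_pos hε)
  have hδ2 : 0 < δ / 2 := half_pos hδ
  have hdiff : Tendsto (fun t => G (t + δ / 2) - G t) atTop (𝓝 0) := by
    have := (hlim.comp (tendsto_atTop_add_const_right atTop (δ / 2) tendsto_id)).sub hlim
    simpa using this
  -- The increment of the primitive over `[t, t + δ / 2]` is at least `δ / 2 * (w t - ε / 2)`.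
  obtain ⟨T, hT⟩ := eventually_atTop.1
    (hdiff.eventually (gt_mem_nhds (show 0 < δ / 2 * (ε / 2) by positivity)))
  refine ⟨max t₀ T, fun t ht => ?_⟩
  have ht₀ : t₀ ≤ t := (le_max_left _ _).trans ht
  have h1 := hT t ((le_max_right _ _).trans ht)
  have htδ : t ≤ t + δ / 2 := by linarith
  rw [hsub t _ ht₀ htδ] at h1
  have h2 : ∫ u in t..t + δ / 2, (w t - ε / 2) ≤ ∫ u in t..t + δ / 2, w u := by
    refine intervalIntegral.integral_mono_on htδ (by simp) (hint _ _ ht₀ (ht₀.trans htδ))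
      fun u hu => ?_
    have := huc t ht₀ u (ht₀.trans hu.1) (by
      rw [Real.dist_eq, abs_lt]; constructor <;> linarith [hu.1, hu.2])
    rw [Real.dist_eq, abs_lt] at this
    linarith
  rw [intervalIntegral.integral_const, smul_eq_mul, add_sub_cancel_left] at h2
  have h3 : w t - ε / 2 < ε / 2 := lt_of_mul_lt_mul_left (h2.trans_lt h1) hδ2.le
  rw [Real.dist_eq, sub_zero, abs_of_nonneg (hnn t ht₀)]
  linarith

end Barbalat

/-! ### Extension of solutions -/

section Solutions

theorem AbsolutelyContinuousOnInterval.congr {X : Type*} [PseudoMetricSpace X] {f g : ℝ → X}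
    {a b : ℝ} (hf : AbsolutelyContinuousOnInterval f a b) (h : EqOn f g (uIcc a b)) :
    AbsolutelyContinuousOnInterval g a b := by
  rw [absolutelyContinuousOnInterval_iff] at hf ⊢
  intro ε hε
  obtain ⟨δ, hδ, hf⟩ := hf ε hε
  refine ⟨δ, hδ, fun P hP hPδ => ?_⟩
  rw [← Finset.sum_congr rfl fun i hi => ?_]
  · exact hf P hP hPδ
  · rw [h (hP.1 i hi).1, h (hP.1 i hi).2]

variable {n : ℕ} {F : EuclideanSpace ℝ (Fin n) → ℝ → Set (EuclideanSpace ℝ (Fin n))}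
  {D : Set (EuclideanSpace ℝ (Fin n))} {t₀ : ℝ} {I : Set ℝ} {x y : ℝ → EuclideanSpace ℝ (Fin n)}

namespace IsInclusionSolution

theorem Icc_subset (hx : IsInclusionSolution F t₀ I x) {b : ℝ} (hb : b ∈ I) : Icc t₀ b ⊆ I :=
  hx.ordConnected.out hx.isLeast.1 hb

theorem ae_mem (hx : IsInclusionSolution F t₀ I x) :
    ∀ᵐ t, t ∈ I → DifferentiableAt ℝ x t ∧ deriv x t ∈ F (x t) t :=
  (ae_restrict_iff' hx.ordConnected.measurableSet).1 hx.inclusion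

/-- The restriction of a solution to a compact initial piece of its interval; values outside that
piece are irrelevant, the derivative at its two ends being immaterial. -/
theorem restrict_Icc (hx : IsInclusionSolution F t₀ I x) {b : ℝ} (hb : b ∈ I) (h : t₀ < b)
    (hxy : EqOn x y (Icc t₀ b)) : IsInclusionSolution F t₀ (Icc t₀ b) y where
  ordConnected := ordConnected_Icc
  nontrivial := ⟨t₀, left_mem_Icc.2 h.le, b, right_mem_Icc.2 h.le, h.ne⟩
  isLeast := isLeast_Icc h.le
  locallyAC a ha c hc :=
    (hx.locallyAC a (hx.Icc_subset hb ha) c (hx.Icc_subset hb hc)).congr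
      (hxy.mono (ordConnected_Icc.uIcc_subset ha hc))
  inclusion := by
    rw [← restrict_Ioo_eq_restrict_Icc, ae_restrict_iff' measurableSet_Ioo]
    filter_upwards [hx.ae_mem] with t ht htb
    have hev : y =ᶠ[𝓝 t] x :=
      (hxy.symm.mono Ioo_subset_Icc_self).eventuallyEq_of_mem (isOpen_Ioo.mem_nhds htb)
    obtain ⟨h1, h2⟩ := ht (hx.Icc_subset hb (Ioo_subset_Icc_self htb))
    rw [hev.differentiableAt_iff, hev.deriv_eq, hev.eq_of_nhds]
    exact ⟨h1, h2⟩

/-- A curve which is a solution over all compact initial pieces of an interval is a solution. The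
exceptional null sets are indexed by rational endpoints. -/
theorem of_forall_Icc {J : Set ℝ} (hJ : J.OrdConnected) (hJn : J.Nontrivial) (hJt : IsLeast J t₀)
    (h : ∀ b ∈ J, t₀ < b → IsInclusionSolution F t₀ (Icc t₀ b) y) :
    IsInclusionSolution F t₀ J y where
  ordConnected := hJ
  nontrivial := hJn
  isLeast := hJt
  locallyAC a ha b hb := by
    have hmax : max a b ∈ J := by rcases max_choice a b with h | h <;> rw [h] <;> assumption
    rcases (hJt.2 hmax).eq_or_lt with he | hlt
    · have ha' : a = t₀ := le_antisymm (he ▸ le_max_left a b) (hJt.2 ha)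
      have hb' : b = t₀ := le_antisymm (he ▸ le_max_right a b) (hJt.2 hb)
      subst ha'
      subst hb'
      refine LipschitzOnWith.absolutelyContinuousOnInterval (K := 0) ?_
      rw [uIcc_self]
      exact LipschitzOnWith.of_dist_le_mul fun u hu v hv => by
        rw [mem_singleton_iff.1 hu, mem_singleton_iff.1 hv]; simp
    · exact (h _ hmax hlt).locallyAC a ⟨hJt.2 ha, le_max_left _ _⟩ b ⟨hJt.2 hb, le_max_right _ _⟩
  inclusion := by
    rw [ae_restrict_iff' hJ.measurableSet]
    have hq : ∀ᵐ t, ∀ q : ℚ, (q : ℝ) ∈ J → t₀ < q → t ∈ Icc t₀ (q : ℝ) →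
        DifferentiableAt ℝ y t ∧ deriv y t ∈ F (y t) t := by
      rw [ae_all_iff]
      intro q
      by_cases hqJ : (q : ℝ) ∈ J ∧ t₀ < q
      · filter_upwards [(h q hqJ.1 hqJ.2).ae_mem] with t ht _ _ using ht
      · exact ae_of_all _ fun t h1 h2 => absurd ⟨h1, h2⟩ hqJ
    have hne : ∀ᵐ t : ℝ, t ≠ sSup J := by simp [ae_iff, measure_singleton]
    filter_upwards [hq, hne] with t ht htne htJ
    have hng : ∃ b ∈ J, t < b := by
      by_contra! hcon
      exact htne (IsGreatest.csSup_eq ⟨htJ, hcon⟩).symm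
    obtain ⟨b, hb, htb⟩ := hng
    obtain ⟨q, htq, hqb⟩ := exists_rat_btwn htb
    have ht₀ := hJt.2 htJ
    exact ht q (hJ.out htJ hb ⟨htq.le, hqb.le⟩) (ht₀.trans_lt htq) ⟨ht₀, htq.le⟩

theorem lipschitzOnWith (hx : IsInclusionSolution F t₀ I x) {J : Set ℝ} (hJ : J.OrdConnected)
    (hJI : J ⊆ I) {M : NNReal} (hM : ∀ t ∈ J, ∀ v ∈ F (x t) t, ‖v‖ ≤ M) :
    LipschitzOnWith M x J := by
  refine LipschitzOnWith.of_dist_le_mul fun a ha b hb => ?_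
  wlog hab : b ≤ a generalizing a b
  · rw [dist_comm, dist_comm a b]
    exact this b hb a ha (le_of_not_ge hab)
  rw [dist_eq_norm, Real.dist_eq, abs_of_nonneg (sub_nonneg.2 hab)]
  refine (hx.locallyAC b (hJI hb) a (hJI ha)).norm_sub_le hab ?_
  rw [ae_restrict_iff' measurableSet_Icc]
  filter_upwards [hx.ae_mem] with t ht htab
  have htJ := hJ.out hb ha htab
  exact ⟨(ht (hJI htJ)).1, hM t htJ _ (ht (hJI htJ)).2⟩

theorem continuousOn_Icc (hx : IsInclusionSolution F t₀ I x) {b : ℝ} (hb : b ∈ I) :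
    ContinuousOn x (Icc t₀ b) := by
  have := (hx.locallyAC t₀ hx.isLeast.1 b hb).continuousOn
  rwa [uIcc_of_le (hx.isLeast.2 hb)] at this

/-- By Zorn's lemma, every solution extends to a maximal one. -/
theorem exists_maximal_extension (hx : IsInclusionSolution F t₀ I x) :
    ∃ (J : Set ℝ) (y : ℝ → EuclideanSpace ℝ (Fin n)),
      I ⊆ J ∧ EqOn x y I ∧ IsMaximalInclusionSolution F t₀ J y := by
  let α := {p : Set ℝ × (ℝ → EuclideanSpace ℝ (Fin n)) //
    IsInclusionSolution F t₀ p.1 p.2 ∧ I ⊆ p.1 ∧ EqOn x p.2 I}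
  let r : α → α → Prop := fun p q => p.1.1 ⊆ q.1.1 ∧ EqOn p.1.2 q.1.2 p.1.1
  have htrans : ∀ {p q s : α}, r p q → r q s → r p s := fun h1 h2 =>
    ⟨h1.1.trans h2.1, fun t ht => (h1.2 ht).trans (h2.2 (h1.1 ht))⟩
  obtain ⟨m, hm⟩ := exists_maximal_of_chains_bounded (r := r) (fun c hc => by
    rcases c.eq_empty_or_nonempty with rfl | ⟨p₀, hp₀⟩
    · exact ⟨⟨(I, x), hx, Subset.rfl, fun _ _ => rfl⟩, fun a ha => ha.elim⟩
    · classical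
      let J : Set ℝ := ⋃ p ∈ c, p.1.1
      let z : ℝ → EuclideanSpace ℝ (Fin n) := fun t =>
        if h : ∃ p ∈ c, t ∈ p.1.1 then h.choose.1.2 t else 0
      have hz : ∀ p ∈ c, EqOn p.1.2 z p.1.1 := by
        intro p hp t ht
        have hex : ∃ p ∈ c, t ∈ p.1.1 := ⟨p, hp, ht⟩
        simp only [z, dif_pos hex]
        rcases eq_or_ne p hex.choose with he | he
        · rw [← he]
        · rcases hc hp hex.choose_spec.1 he with h | h
          · exact h.2 ht
          · exact (h.2 hex.choose_spec.2).symm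
      have hpJ : ∀ p ∈ c, p.1.1 ⊆ J := fun p hp =>
        subset_biUnion_of_mem (u := fun p : α => p.1.1) hp
      have hJex : ∀ b ∈ J, ∃ p ∈ c, b ∈ p.1.1 := fun b hb => by simpa [J] using hb
      have hJt : IsLeast J t₀ := by
        refine ⟨hpJ p₀ hp₀ p₀.2.1.isLeast.1, fun b hb => ?_⟩
        obtain ⟨p, -, hpb⟩ := hJex b hb
        exact p.2.1.isLeast.2 hpb
      have hJo : J.OrdConnected := ⟨fun a ha b hb t ht => by
        obtain ⟨p, hp, hpb⟩ := hJex b hb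
        exact hpJ p hp (p.2.1.Icc_subset hpb ⟨(hJt.2 ha).trans ht.1, ht.2⟩)⟩
      refine ⟨⟨(J, z), of_forall_Icc hJo (p₀.2.1.nontrivial.mono (hpJ p₀ hp₀)) hJt
        fun b hb hlt => ?_, p₀.2.2.1.trans (hpJ p₀ hp₀),
        fun t ht => (p₀.2.2.2 ht).trans (hz p₀ hp₀ (p₀.2.2.1 ht))⟩,
        fun p hp => ⟨hpJ p hp, hz p hp⟩⟩
      obtain ⟨p, hp, hpb⟩ := hJex b hb
      exact p.2.1.restrict_Icc hpb hlt ((hz p hp).mono (p.2.1.Icc_subset hpb))) htrans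
  refine ⟨m.1.1, m.1.2, m.2.2.1, m.2.2.2, m.2.1, fun J y hy hJ hmy => ?_⟩
  have h := hm ⟨(J, y), hy, m.2.2.1.trans hJ,
    fun t ht => (m.2.2.2 ht).trans (hmy (m.2.2.1 ht))⟩ ⟨hJ, hmy⟩
  exact h.1.antisymm hJ

end IsInclusionSolution

theorem LipschitzWith.ite_le {X : Type*} [PseudoMetricSpace X] {f g : ℝ → X} {K L : NNReal}
    (hf : LipschitzWith K f) (hg : LipschitzWith L g) {T : ℝ} (h : f T = g T) :
    LipschitzWith (max K L) (fun t => if t ≤ T then f t else g t) := by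
  refine LipschitzWith.of_dist_le_mul fun a b => ?_
  wlog hab : a ≤ b generalizing a b
  · rw [dist_comm, dist_comm a b]
    exact this b a (le_of_not_ge hab)
  have hf' := (hf.weaken (le_max_left K L)).dist_le_mul
  have hg' := (hg.weaken (le_max_right K L)).dist_le_mul
  by_cases hb : b ≤ T
  · simp only [hab.trans hb, hb, if_true]
    exact hf' a b
  by_cases ha : a ≤ T
  · simp only [ha, hb, if_true, if_false]
    have h1 := hf' a T
    have h2 := hg' T b
    have h3 := dist_triangle (f a) (f T) (g b)
    rw [← h] at h2
    have h4 : dist a T + dist T b = dist a b := by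
      simp only [Real.dist_eq]
      rw [abs_of_nonpos (by linarith), abs_of_nonpos (by linarith), abs_of_nonpos (by linarith)]
      ring
    rw [← h4, mul_add]
    linarith
  · simp only [ha, hb, if_false]
    exact hg' a b

/-- A solution over a bounded interval that stays in a compact part of the open set `D` can be
continued beyond the right end of the interval, whether or not that end belongs to it. -/
theorem IsInclusionSolution.exists_proper_extension (hDo : IsOpen D)
    (hF : SatisfiesFilippov F t₀) (hFb : LocallyBoundedUniformly F D t₀)
    (hx : IsInclusionSolution F t₀ I x) {K : Set (EuclideanSpace ℝ (Fin n))} (hK : IsCompact K)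
    (hKD : K ⊆ D) (hxK : MapsTo x I K) (hI : BddAbove I) :
    ∃ (J : Set ℝ) (y : ℝ → EuclideanSpace ℝ (Fin n)),
      IsInclusionSolution F t₀ J y ∧ I ⊆ J ∧ EqOn x y I ∧ J ≠ I := by
  obtain ⟨M, hM0, hM⟩ := hFb K hKD hK
  lift M to NNReal using hM0.le
  obtain ⟨y, hyl, hxy⟩ := (hx.lipschitzOnWith hx.ordConnected Subset.rfl fun t ht =>
    hM (x t) (hxK ht) t (hx.isLeast.2 ht)).extend_finite_dimension
  have hIne : I.Nonempty := hx.nontrivial.nonempty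
  set T := sSup I
  have ht₀T : t₀ < T := by
    obtain ⟨b, hb, hne⟩ := hx.nontrivial.exists_ne t₀
    exact (lt_of_le_of_ne (hx.isLeast.2 hb) hne.symm).trans_le (le_csSup hI hb)
  have hIT : ∀ t ∈ I, t ≤ T := fun t ht => le_csSup hI ht
  have hTI : ∀ t, t₀ ≤ t → t < T → t ∈ I := fun t h1 h2 => by
    obtain ⟨b, hb, htb⟩ := exists_lt_of_lt_csSup hIne h2
    exact hx.Icc_subset hb ⟨h1, htb.le⟩
  have hyK : y T ∈ K := by
    have h1 : MapsTo y I K := fun t ht => hxy ht ▸ hxK ht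
    have := map_mem_closure hyl.continuous (csSup_mem_closure hIne hI) h1
    rwa [hK.isClosed.closure_eq] at this
  obtain ⟨a, ha, b, hb, hFil, m, hm, hsel⟩ := hF (y T) T ht₀T.le
  obtain ⟨ρ, hρ, hρD⟩ := Metric.nhds_basis_closedBall.mem_iff.1 (hDo.mem_nhds (hKD hyK))
  have hball : Metric.closedBall (y T) (min b ρ) ⊆ Metric.closedBall (y T) b :=
    Metric.closedBall_subset_closedBall (min_le_left _ _)
  obtain ⟨N, hN0, hN⟩ := hFb (Metric.closedBall (y T) (min b ρ))
    ((Metric.closedBall_subset_closedBall (min_le_right _ _)).trans hρD)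
    (isCompact_closedBall _ _)
  lift N to NNReal using hN0.le
  have hbρ : 0 < min b ρ := lt_min hb hρ
  set a' := min a (min b ρ / N)
  have ha' : 0 < a' := lt_min ha (div_pos hbρ hN0)
  have hIcc : Icc T (T + a') ⊆ Icc T (T + a) :=
    Icc_subset_Icc_right (by linarith [min_le_left a (min b ρ / N)])
  obtain ⟨z, hzl, hzT, hz⟩ := exists_local_solution_of_bounded (F := F) (x₀ := y T) (s := T)
    (a := a') (b := min b ρ) (M := N) ha'
    (by
      have : a' ≤ min b ρ / N := min_le_right _ _
      rwa [le_div_iff₀ hN0, mul_comm] at this)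
    (by
      filter_upwards [ae_restrict_of_ae_restrict_of_subset hIcc hFil] with t ht w hw
      obtain ⟨h1, h2, h3, h4⟩ := ht w (hball hw)
      exact ⟨h1, h2, h3, fun ε hε => (h4 ε hε).filter_mono (nhdsWithin_mono _ hball)⟩)
    (fun w hw => by
      obtain ⟨f, hf1, hf2⟩ := hsel w (hball hw)
      exact ⟨f, hf1.mono_measure (Measure.restrict_mono hIcc le_rfl),
        (ae_restrict_of_ae_restrict_of_subset hIcc hf2).mono fun t ht => ht.1⟩)
    (fun w hw t ht => hN w hw t (ht₀T.le.trans ht.1))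
  set g : ℝ → EuclideanSpace ℝ (Fin n) := fun t => if t ≤ T then y t else z t
  have hgl := hyl.ite_le hzl hzT.symm
  refine ⟨Icc t₀ (T + a'), g, ?_, fun t ht => ⟨hx.isLeast.2 ht, by linarith [hIT t ht]⟩,
    fun t ht => ?_, fun he => ?_⟩
  · refine ⟨ordConnected_Icc, ⟨t₀, left_mem_Icc.2 (by linarith), T, ⟨ht₀T.le, by linarith⟩, ht₀T.ne⟩,
      isLeast_Icc (by linarith),
      fun c _ d _ => hgl.lipschitzOnWith.absolutelyContinuousOnInterval, ?_⟩
    rw [ae_restrict_iff' measurableSet_Icc]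
    rw [ae_restrict_iff' measurableSet_Icc] at hz
    have h1 : ∀ᵐ t : ℝ, t ≠ T := by simp [ae_iff, measure_singleton]
    have h2 : ∀ᵐ t : ℝ, t ≠ t₀ := by simp [ae_iff, measure_singleton]
    filter_upwards [hz, hx.ae_mem, h1, h2] with t hzt hxt htT htt₀ ht
    rcases lt_or_gt_of_ne htT with hlt | hgt
    · have htI : t ∈ I := hTI t ht.1 hlt
      have hev : g =ᶠ[𝓝 t] x := by
        filter_upwards [Ioo_mem_nhds (lt_of_le_of_ne ht.1 htt₀.symm) hlt] with τ hτ
        simp only [g, hτ.2.le, if_true]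
        exact (hxy (hTI τ hτ.1.le hτ.2)).symm
      rw [hev.differentiableAt_iff, hev.deriv_eq, hev.eq_of_nhds]
      exact hxt htI
    · have hev : g =ᶠ[𝓝 t] z := by
        filter_upwards [Ioi_mem_nhds hgt] with τ hτ
        simp only [g, not_le.2 (mem_Ioi.1 hτ), if_false]
      rw [hev.differentiableAt_iff, hev.deriv_eq, hev.eq_of_nhds]
      exact hzt ⟨hgt.le, ht.2⟩
  · simp only [g, hIT t ht, if_true]
    exact hxy ht
  · have : T + a' ∈ I := he ▸ right_mem_Icc.2 (by linarith)
    linarith [hIT _ this]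

end Solutions

/-! ### Lyapunov functions -/

section Lyapunov

variable {n : ℕ} {F : EuclideanSpace ℝ (Fin n) → ℝ → Set (EuclideanSpace ℝ (Fin n))}
  {D : Set (EuclideanSpace ℝ (Fin n))} {t₀ : ℝ} {V : EuclideanSpace ℝ (Fin n) × ℝ → ℝ}
  {Wlo Whi W : EuclideanSpace ℝ (Fin n) → ℝ} {I : Set ℝ} {x : ℝ → EuclideanSpace ℝ (Fin n)}

/-- For almost every `t ≥ t₀`, the derivative at `t` of `V` along any curve in `D` whose velocity
at `t` lies in `F` is at most `-W`. Both kinds of Lyapunov functions have this property, and the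
rest of the argument uses nothing else about Clarke gradients. -/
def DecreasesAlongInclusion (F : EuclideanSpace ℝ (Fin n) → ℝ → Set (EuclideanSpace ℝ (Fin n)))
    (D : Set (EuclideanSpace ℝ (Fin n))) (t₀ : ℝ) (V : EuclideanSpace ℝ (Fin n) × ℝ → ℝ)
    (W : EuclideanSpace ℝ (Fin n) → ℝ) : Prop :=
  ∀ᵐ t ∂(volume.restrict (Ici t₀)), ∀ (x : ℝ → EuclideanSpace ℝ (Fin n)) (d : ℝ), x t ∈ D →
    DifferentiableAt ℝ x t → deriv x t ∈ F (x t) t → HasDerivAt (fun τ => V (x τ, τ)) d t →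
    d ≤ -W (x t)

theorem IsLyapunovCandidate.exists_lipschitzOnWith_nhds
    (hV : IsLyapunovCandidate F D t₀ V Wlo Whi W) (hDo : IsOpen D)
    {z : EuclideanSpace ℝ (Fin n)} (hz : z ∈ D) {t : ℝ} (ht : t₀ < t) :
    ∃ K, ∃ s ∈ 𝓝 (z, t), LipschitzOnWith K V s := by
  obtain ⟨K, s, hs, hK⟩ := hV.locallyLipschitz (show (z, t) ∈ D ×ˢ Ici t₀ from ⟨hz, ht.le⟩)
  rw [nhdsWithin_eq_nhds.2 (prod_mem_nhds (hDo.mem_nhds hz) (Ici_mem_nhds ht))] at hs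
  exact ⟨K, s, hs, hK⟩

theorem decreasesAlongInclusion (hDo : IsOpen D)
    (hV : IsNonstrictLyapunov F D t₀ V Wlo Whi W ∨ IsRegularRelaxedLyapunov F D t₀ V Wlo Whi W) :
    DecreasesAlongInclusion F D t₀ V W := by
  have hlt : ∀ᵐ t ∂(volume.restrict (Ici t₀)), t₀ < t := by
    rw [← restrict_Ioi_eq_restrict_Ici]
    exact ae_restrict_mem measurableSet_Ioi
  rcases hV with ⟨hC, hd⟩ | ⟨hC, hr, hd⟩
  · filter_upwards [hd, hlt] with t ht ht₀ x d hxD hx hxF hdx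
    obtain ⟨K, s, hs, hK⟩ := hC.exists_lipschitzOnWith_nhds hDo hxD ht₀
    exact EReal.coe_le_coe_iff.1 ((le_upperTimeDeriv hs hK hx hxF hdx).trans (ht _ hxD))
  · filter_upwards [hd, hlt] with t ht ht₀ x d hxD hx hxF hdx
    obtain ⟨K, s, hs, hK⟩ := hC.exists_lipschitzOnWith_nhds hDo hxD ht₀
    exact EReal.coe_le_coe_iff.1
      ((le_lowerTimeDeriv hs hK (hr _ hxD _ ht₀) hx hxF hdx).trans (ht _ hxD))

/-- The energy inequality along solutions, obtained by integrating the derivative of the Lipschitz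
function `t ↦ V (x t, t)`. -/
theorem IsInclusionSolution.lyapunov_add_integral_le (hFb : LocallyBoundedUniformly F D t₀)
    (hC : IsLyapunovCandidate F D t₀ V Wlo Whi W) (hd : DecreasesAlongInclusion F D t₀ V W)
    (hx : IsInclusionSolution F t₀ I x) {b : ℝ} (hb : b ∈ I) (hxD : MapsTo x (Icc t₀ b) D) :
    V (x b, b) + ∫ t in t₀..b, W (x t) ≤ V (x t₀, t₀) := by
  have htb : t₀ ≤ b := hx.isLeast.2 hb
  have hcont := hx.continuousOn_Icc hb
  obtain ⟨M, hM0, hM⟩ := hFb (x '' Icc t₀ b) hxD.image_subset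
    (isCompact_Icc.image_of_continuousOn hcont)
  lift M to NNReal using hM0.le
  have hxl : LipschitzOnWith M x (Icc t₀ b) :=
    hx.lipschitzOnWith ordConnected_Icc (hx.Icc_subset hb) fun t ht =>
      hM _ (mem_image_of_mem x ht) t ht.1
  set γ : ℝ → EuclideanSpace ℝ (Fin n) × ℝ := fun t => (x t, t)
  have hγl : LipschitzOnWith (max M 1) γ (Icc t₀ b) :=
    hxl.prodMk (LipschitzWith.id.lipschitzOnWith)
  have hγS : MapsTo γ (Icc t₀ b) (D ×ˢ Ici t₀) := fun t ht => ⟨hxD ht, ht.1⟩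
  obtain ⟨L, hL⟩ := (hC.locallyLipschitz.mono hγS.image_subset).exists_lipschitzOnWith_of_compact
    (isCompact_Icc.image_of_continuousOn hγl.continuousOn)
  have hφl : LipschitzOnWith (L * max M 1) (fun t => V (x t, t)) (Icc t₀ b) :=
    hL.comp hγl (mapsTo_image γ _)
  have hφ : AbsolutelyContinuousOnInterval (fun t => V (x t, t)) t₀ b :=
    LipschitzOnWith.absolutelyContinuousOnInterval (by rwa [uIcc_of_le htb])
  have hWc : ContinuousOn (fun t => W (x t)) (Icc t₀ b) := hC.continuousOn_W.comp hcont hxD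
  have hWi : IntervalIntegrable (fun t => W (x t)) volume t₀ b :=
    ContinuousOn.intervalIntegrable (by rwa [uIcc_of_le htb])
  have key : ∫ t in t₀..b, deriv (fun t => V (x t, t)) t ≤ ∫ t in t₀..b, -W (x t) := by
    refine intervalIntegral.integral_mono_ae_restrict htb hφ.intervalIntegrable_deriv hWi.neg ?_
    have h2 : ∀ᵐ t ∂(volume.restrict (Icc t₀ b)),
        DifferentiableAt ℝ (fun t => V (x t, t)) t := by
      rw [ae_restrict_iff' measurableSet_Icc]
      simpa only [uIcc_of_le htb] using hφ.ae_differentiableAt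
    filter_upwards [h2, ae_restrict_of_ae_restrict_of_subset (hx.Icc_subset hb) hx.inclusion,
      ae_restrict_of_ae_restrict_of_subset Icc_subset_Ici_self hd,
      ae_restrict_mem measurableSet_Icc]
      with t h2 h3 h4 ht
    exact h4 x _ (hxD ht) h3.1 h3.2 h2.hasDerivAt
  rw [hφ.integral_deriv_eq_sub, intervalIntegral.integral_neg] at key
  linarith

theorem IsLyapunovCandidate.nonneg (hC : IsLyapunovCandidate F D t₀ V Wlo Whi W)
    {z : EuclideanSpace ℝ (Fin n)} (hz : z ∈ D) {t : ℝ} (ht : t₀ ≤ t) : 0 ≤ V (z, t) := by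
  rcases eq_or_ne z 0 with rfl | h
  · exact (hC.posDef t ht).1.ge
  · exact ((hC.posDef t ht).2 z hz h).le

theorem IsInclusionSolution.lo_le_hi_initial (hFb : LocallyBoundedUniformly F D t₀)
    (hC : IsLyapunovCandidate F D t₀ V Wlo Whi W) (hd : DecreasesAlongInclusion F D t₀ V W)
    (hx : IsInclusionSolution F t₀ I x) {b : ℝ} (hb : b ∈ I) (hxD : MapsTo x (Icc t₀ b) D) :
    Wlo (x b) ≤ Whi (x t₀) := by
  have htb : t₀ ≤ b := hx.isLeast.2 hb
  have h1 := hx.lyapunov_add_integral_le hFb hC hd hb hxD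
  have h2 : 0 ≤ ∫ t in t₀..b, W (x t) :=
    intervalIntegral.integral_nonneg htb fun t ht => hC.nonneg_W _ (hxD ht)
  have h3 := hC.lo_le _ (hxD (right_mem_Icc.2 htb)) b htb
  have h4 := hC.le_hi _ (hxD (left_mem_Icc.2 htb)) t₀ le_rfl
  linarith

/-- Confinement to a compact subset of `D` is all that has to be known of a solution. -/
theorem completeBoundedConvergent_of_mapsTo_compact (hDo : IsOpen D)
    (hF : SatisfiesFilippov F t₀) (hFb : LocallyBoundedUniformly F D t₀)
    (hC : IsLyapunovCandidate F D t₀ V Wlo Whi W) (hd : DecreasesAlongInclusion F D t₀ V W)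
    (hx : IsInclusionSolution F t₀ I x) {K : Set (EuclideanSpace ℝ (Fin n))} (hK : IsCompact K)
    (hKD : K ⊆ D) (hxK : MapsTo x I K) : CompleteBoundedConvergent F D t₀ W I x := by
  refine ⟨hxK.mono_right hKD, hK.isBounded.subset hxK.image_subset, hx.exists_maximal_extension,
    fun hmax => ?_⟩
  have hI : I = Ici t₀ := by
    have hnb : ¬ BddAbove I := fun hb => by
      obtain ⟨J, y, hy, hIJ, hxy, hne⟩ :=
        hx.exists_proper_extension hDo hF hFb hK hKD hxK hb
      exact hne (hmax.2 J y hy hIJ hxy)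
    refine Subset.antisymm (fun t ht => hx.isLeast.2 ht) fun t ht => ?_
    obtain ⟨b, hb, htb⟩ := not_bddAbove_iff.1 hnb t
    exact hx.Icc_subset hb ⟨ht, htb.le⟩
  refine ⟨hI, ?_⟩
  subst hI
  obtain ⟨M, hM0, hM⟩ := hFb K hKD hK
  lift M to NNReal using hM0.le
  have hxl : LipschitzOnWith M x (Ici t₀) :=
    hx.lipschitzOnWith ordConnected_Ici Subset.rfl fun t ht => hM _ (hxK ht) t ht
  refine tendsto_zero_of_uniformContinuousOn_of_integral_le (t₀ := t₀) (C := V (x t₀, t₀))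
    ((hK.uniformContinuousOn_of_continuous (hC.continuousOn_W.mono hKD)).comp
      hxl.uniformContinuousOn hxK) (fun t ht => hC.nonneg_W _ (hKD (hxK ht))) fun t ht => ?_
  have h1 := hx.lyapunov_add_integral_le hFb hC hd ht
    fun τ hτ => hKD (hxK (mem_Ici.2 hτ.1))
  have h2 := hC.nonneg (hKD (hxK ht)) ht
  linarith

/-- A solution that starts in the ball, with `Wlo` too large on the sphere to be reached, never
leaves the ball: at the first time on or outside the sphere it would be on the sphere. -/
theorem IsInclusionSolution.mapsTo_closedBall (hFb : LocallyBoundedUniformly F D t₀)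
    (hC : IsLyapunovCandidate F D t₀ V Wlo Whi W) (hd : DecreasesAlongInclusion F D t₀ V W)
    (hx : IsInclusionSolution F t₀ I x) {r c : ℝ} (hrD : Metric.closedBall 0 r ⊆ D)
    (hc : ∀ z ∈ Metric.sphere 0 r, c < Wlo z) (hx₀ : x t₀ ∈ Metric.closedBall 0 r)
    (hx₀c : Whi (x t₀) ≤ c) : MapsTo x I (Metric.closedBall 0 r) := by
  have hno : ∀ b ∈ I, MapsTo x (Icc t₀ b) (Metric.closedBall 0 r) → ‖x b‖ ≠ r := by
    intro b hb hmaps he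
    have h1 := hx.lo_le_hi_initial hFb hC hd hb (hmaps.mono_right hrD)
    have h2 := hc (x b) (by simpa using he)
    linarith
  intro b hb
  by_contra hxb
  have htb : t₀ ≤ b := hx.isLeast.2 hb
  have hcont : ContinuousOn (fun t => ‖x t‖) (Icc t₀ b) := (hx.continuousOn_Icc hb).norm
  set S := Icc t₀ b ∩ (fun t => ‖x t‖) ⁻¹' Ici r
  have hSc : IsCompact S := isCompact_Icc.of_isClosed_subset
    (hcont.preimage_isClosed_of_isClosed isClosed_Icc isClosed_Ici) inter_subset_left
  have hSne : S.Nonempty := ⟨b, right_mem_Icc.2 htb, by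
    rw [mem_closedBall_zero_iff, not_le] at hxb
    exact hxb.le⟩
  obtain ⟨τ, hτS, hτ⟩ := hSc.exists_isLeast hSne
  have hbefore : ∀ t ∈ Ico t₀ τ, ‖x t‖ < r := fun t ht => by
    by_contra hcon
    exact (hτ ⟨⟨ht.1, ht.2.le.trans hτS.1.2⟩, not_lt.1 hcon⟩).not_gt ht.2
  have hτr : ‖x τ‖ ≤ r := by
    rcases hτS.1.1.eq_or_lt with he | hlt
    · rw [← he]
      simpa using hx₀
    · have hIco : Icc t₀ τ ⊆ Icc t₀ b := Icc_subset_Icc_right hτS.1.2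
      have h1 : Tendsto (fun t => ‖x t‖) (𝓝[Ico t₀ τ] τ) (𝓝 ‖x τ‖) :=
        ((hcont τ hτS.1).mono (Ico_subset_Icc_self.trans hIco))
      have : (𝓝[Ico t₀ τ] τ).NeBot := by
        rw [← mem_closure_iff_nhdsWithin_neBot, closure_Ico hlt.ne]
        exact right_mem_Icc.2 hlt.le
      exact le_of_tendsto h1 (eventually_nhdsWithin_of_forall fun t ht => (hbefore t ht).le)
  refine hno τ (hx.Icc_subset hb hτS.1) (fun t ht => ?_) (hτr.antisymm hτS.2)
  rw [mem_closedBall_zero_iff]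
  rcases ht.2.eq_or_lt with rfl | hlt
  · exact hτr
  · exact (hbefore t ⟨ht.1, hlt⟩).le

end Lyapunov

/-! ### Stability -/

theorem theorem1 {n : ℕ} (D : Set (EuclideanSpace ℝ (Fin n))) (hDo : IsOpen D)
    (hDc : IsConnected D) (t₀ : ℝ)
    (F : EuclideanSpace ℝ (Fin n) → ℝ → Set (EuclideanSpace ℝ (Fin n)))
    (hF : SatisfiesFilippov F t₀) (hFb : LocallyBoundedUniformly F D t₀)
    (V : EuclideanSpace ℝ (Fin n) × ℝ → ℝ) (Wlo Whi W : EuclideanSpace ℝ (Fin n) → ℝ)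
    (hV : IsNonstrictLyapunov F D t₀ V Wlo Whi W ∨ IsRegularRelaxedLyapunov F D t₀ V Wlo Whi W) :
    (∀ r > 0, Metric.closedBall 0 r ⊆ D →
      ∀ c > 0, (∀ z ∈ Metric.sphere 0 r, c < Wlo z) →
      ∀ (I : Set ℝ) (x : ℝ → EuclideanSpace ℝ (Fin n)), IsInclusionSolution F t₀ I x →
        x t₀ ∈ Metric.closedBall 0 r → Whi (x t₀) ≤ c →
        CompleteBoundedConvergent F D t₀ W I x) ∧
    (D = univ → (∀ c > 0, IsCompact {z | Wlo z ≤ c}) →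
      ∀ (I : Set ℝ) (x : ℝ → EuclideanSpace ℝ (Fin n)), IsInclusionSolution F t₀ I x →
        CompleteBoundedConvergent F D t₀ W I x) := by
  have hC : IsLyapunovCandidate F D t₀ V Wlo Whi W := hV.elim (·.1) (·.1)
  have hd := decreasesAlongInclusion hDo hV
  constructor
  · intro r _ hrD c _ hc I x hx hx₀ hx₀c
    exact completeBoundedConvergent_of_mapsTo_compact hDo hF hFb hC hd hx
      (isCompact_closedBall 0 r) hrD (hx.mapsTo_closedBall hFb hC hd hrD hc hx₀ hx₀c)
  · intro hD hcpt I x hx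
    have hmem : ∀ z, z ∈ D := fun z => hD ▸ mem_univ z
    -- The level is raised by one because it has to be positive, also when `x t₀ = 0`.
    have hlevel : 0 ≤ Whi (x t₀) :=
      (hC.nonneg (hmem _) le_rfl).trans (hC.le_hi _ (hmem _) t₀ le_rfl)
    refine completeBoundedConvergent_of_mapsTo_compact hDo hF hFb hC hd hx
      (hcpt (Whi (x t₀) + 1) (by linarith)) (fun z _ => hmem z) fun b hb => ?_
    have := hx.lo_le_hi_initial hFb hC hd hb fun t _ => hmem _
    show Wlo (x b) ≤ Whi (x t₀) + 1
    linarith
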